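/- **Setting.** Let $\tau,\beta\in\mathbb R$, $T>0$. Let $\omega:\mathbb R\to\mathbb R$ satisfy $\omega_0=0$ and be $\gamma_1$-Hölder continuous on every interval $[-k,k]$, $k\in\mathbb N$, for some $\gamma_1\in(\tfrac12,1)$ (almost every path of a fractional Brownian motion with Hurst index $\mathcal H\in(\frac12,1)$ is of this kind for every $\gamma_1<\mathcal H$). Put $z_t=e^{-\beta\omega_t}$. Let $H$ be a real separable Hilbert space and $V$ a real reflexive Banach space, continuously, densely and compactly embedded in $H$, so that $V\subseteq H\equiv H^*\subseteq V^*$. Let $A:\mathbb R\times V\to V^*$ be Borel measurable, $\alpha\ge 2$, $\varpi\ge 0$, $c,C\ge0$, $f,g\in L^1([\tau,\tau+T];\mathbb R)$, and let $\eta,\rho:V\to[0,\infty)$ be measurable and locally bounded, such that for all $t\in[\tau,\tau+T]$ and $v,v_1,v_2\in V$: - $(A1')$ $s\mapsto {}_{V^*}\langle A(t,v_1+sv_2),v\rangle_V$ is continuous on $\mathbb R$; - $(A2')$ $2\,{}_{V^*}\langle A(t,v_1)-A(t,v_2),v_1-v_2\rangle_V\le (f(t)+\eta(v_1)+\rho(v_2))\|v_1-v_2\|_H^2$;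 - $(A3')$ $2\,{}_{V^*}\langle A(t,v),v\rangle_V\le -c\|v\|_V^\alpha+g(t)\|v\|_H^2+f(t)$; - $(A4')$ $\|A(t,v)\|_{V^*}^{\alpha/(\alpha-1)}\le C(f(t)+\|v\|_V^\alpha)(1+\|v\|_H^\varpi)$. **Solutions.** A function $\tilde u\in C([\tau,\tau+T];H)\cap L^\alpha([\tau,\tau+T];V)$ is a *solution of the random PDE* $d\tilde u(t)=z_tA(t,z_t^{-1}\tilde u(t))\,dt$ with initial value $\tilde u_\tau\in H$ if for all $v\in V$, $t\in[\tau,\tau+T]$ $$\langle \tilde u(t),v\rangle_H=\langle\tilde u_\tau,v\rangle_H+\int_\tau^t z_r\;{}_{V^*}\langle A(r,z_r^{-1}\tilde u(r)),v\rangle_V\,dr .$$ For $\gamma_2>0$ with $\gamma_1+\gamma_2>1$, a function $u\in C([\tau,\tau+T];H)\cap L^\alpha([\tau,\tau+T];V)$ is a *($\gamma_2$-Hölder) solution of the SPDE* $du_t=A(t,u_t)\,dt+\beta u_t\,d\omega_t$ with initial value $u_\tau\in H$ if for every $v\in V$ the function $\langle u(\cdot),v\rangle_H$ is $\gamma_2$-Hölder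 continuous on $[\tau,\tau+T]$ and for all $t\in[\tau,\tau+T]$ $$\langle u(t),v\rangle_H=\langle u_\tau,v\rangle_H+\int_\tau^t {}_{V^*}\langle A(r,u(r)),v\rangle_V\,dr+\int_\tau^t\beta\langle u(r),v\rangle_H\,d\omega_r ,$$ the last integral being a Young integral (limit of left-point Riemann–Stieltjes sums as the mesh tends to $0$). **Theorem.** There is a constant $C(T,\tau,\omega,\beta)>0$, depending only on the quantities indicated, such that in every such setting the following holds. (1) Let $u_\tau^1,u_\tau^2\in H$ and let $\tilde u_1,\tilde u_2$ be solutions of the random PDE with initial values $\tilde u_{i,\tau}=z_\tau u^i_\tau$ such that $\int_\tau^{\tau+T}\big(\rho(z_s^{-1}\tilde u_1(s))+\eta(z_s^{-1}\tilde u_2(s))\big)ds<\infty$. Then for all $t\in[\tau,\tau+T]$ $$\|\tilde u_1(t)-\tilde u_2(t)\|_H^2\le \exp\Big[\int_\tau^t\big(f(s)+\rho(z_s^{-1}\tilde u_1(s))+\eta(z_s^{-1}\tilde u_2(s))\big)ds\Big]\,\|\tilde u_{1,\tau}-\tilde u_{2,\tau}\|_H^2 ,$$ and $u_i(t)=z_t^{-1}\tilde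 u_i(t)$ satisfy $$\|u_1(t)-u_2(t)\|_H^2\le C(T,\tau,\omega,\beta)\exp\Big[\int_\tau^t\big(f(s)+\rho(u_1(s))+\eta(u_2(s))\big)ds\Big]\,\|u^1_\tau-u^2_\tau\|_H^2 .$$ Moreover $u_1,u_2$ are solutions of the SPDE with initial values $u^1_\tau,u^2_\tau$, for every Hölder exponent $\gamma_2\le\frac1\alpha\wedge\gamma_1$ with $\gamma_1+\gamma_2>1$. (2) The last inequality holds for any two solutions $u_1,u_2$ of the SPDE with initial values $u^1_\tau,u^2_\tau\in H$ (for a Hölder exponent $\gamma_2$ with $\gamma_1+\gamma_2>1$) such that $\int_\tau^{\tau+T}(\rho(u_1(s))+\eta(u_2(s)))\,ds<\infty$. -/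

import Mathlib

open MeasureTheory Set Topology
open scoped NNReal RealInnerProductSpace

noncomputable section

namespace FractionalSPDE

section Triple

variable {V H : Type*} [NormedAddCommGroup V] [NormedSpace ℝ V]
  [NormedAddCommGroup H] [InnerProductSpace ℝ H]

/-- The embedding `V ⊆ H` of a Gelfand triple `V ⊆ H ≡ H* ⊆ V*`, written as an injective continuous
linear map `ι : V → H`: the space `V` is reflexive (the canonical map `V → V**` is onto), and the
embedding is dense and compact. -/
structure IsCompactGelfandEmbedding (ι : V →L[ℝ] H) : Prop where
  reflexive : Function.Surjective (NormedSpace.inclusionInDoubleDual ℝ V)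
  injective : Function.Injective ι
  dense : DenseRange ι
  compact : IsCompactOperator ι

/-- An element of `H` that lies in `V ⊆ H`, regarded as an element of `V` (a meaningless value
for elements of `H` outside `V`). -/
def toV (ι : V →L[ℝ] H) (h : H) : V := Function.invFun ι h

/-- `u ∈ C([τ, τ + T]; H) ∩ L^α([τ, τ + T]; V)`. -/
structure IsContinuousLp (ι : V →L[ℝ] H) (α τ T : ℝ) (u : ℝ → H) : Prop where
  continuousOn : ContinuousOn u (Icc τ (τ + T))
  ae_mem : ∀ᵐ s ∂(volume.restrict (Icc τ (τ + T))), u s ∈ range ι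
  memLp : MemLp (fun s => toV ι (u s)) (ENNReal.ofReal α) (volume.restrict (Icc τ (τ + T)))

/-- The standing assumptions on the nonautonomous drift `A : ℝ × V → V*`: joint Borel
measurability, hemicontinuity, local monotonicity, coercivity and growth on `[τ, τ + T]`. -/
structure DriftAssumptions [MeasurableSpace V] (ι : V →L[ℝ] H) (A : ℝ → V → StrongDual ℝ V)
    (τ T α ϖ c C : ℝ) (f g : ℝ → ℝ) (η ρ : V → ℝ) : Prop where
  two_le_alpha : 2 ≤ α
  varpi_nonneg : 0 ≤ ϖ
  c_nonneg : 0 ≤ c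
  C_nonneg : 0 ≤ C
  measurable_A : Measurable (fun p : ℝ × V => A p.1 p.2)
  integrable_f : IntegrableOn f (Icc τ (τ + T))
  integrable_g : IntegrableOn g (Icc τ (τ + T))
  measurable_eta : Measurable η
  measurable_rho : Measurable ρ
  eta_nonneg : ∀ v, 0 ≤ η v
  rho_nonneg : ∀ v, 0 ≤ ρ v
  eta_locallyBounded : ∀ v, ∃ M : ℝ, ∀ᶠ w in 𝓝 v, η w ≤ M
  rho_locallyBounded : ∀ v, ∃ M : ℝ, ∀ᶠ w in 𝓝 v, ρ w ≤ M
  hemicontinuity : ∀ t ∈ Icc τ (τ + T), ∀ v v₁ v₂ : V,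
    Continuous (fun s : ℝ => A t (v₁ + s • v₂) v)
  local_monotonicity : ∀ t ∈ Icc τ (τ + T), ∀ v₁ v₂ : V,
    2 * (A t v₁ - A t v₂) (v₁ - v₂) ≤ (f t + η v₁ + ρ v₂) * ‖ι (v₁ - v₂)‖ ^ 2
  coercivity : ∀ t ∈ Icc τ (τ + T), ∀ v : V,
    2 * A t v v ≤ -c * ‖v‖ ^ α + g t * ‖ι v‖ ^ 2 + f t
  growth : ∀ t ∈ Icc τ (τ + T), ∀ v : V,
    ‖A t v‖ ^ (α / (α - 1)) ≤ C * (f t + ‖v‖ ^ α) * (1 + ‖ι v‖ ^ ϖ)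

end Triple

/-- Noise paths: `ω 0 = 0` and `ω` is `γ₁`-Hölder continuous on every interval `[-k, k]`. -/
def IsNoisePath (γ₁ : ℝ≥0) (ω : ℝ → ℝ) : Prop :=
  ω 0 = 0 ∧ ∀ k : ℕ, ∃ K : ℝ≥0, HolderOnWith K γ₁ ω (Icc (-(k : ℝ)) k)

/-- `I` is the Young integral `∫_a^b y dx` (for `a ≤ b`): the limit of the left-point sums
`∑ y(pᵢ) (x(pᵢ₊₁) - x(pᵢ))` over finite partitions `a = p₀ ≤ p₁ ≤ ⋯ ≤ pₙ = b`, as the mesh of the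
partition tends to zero. -/
def HasYoungIntegral (y x : ℝ → ℝ) (a b I : ℝ) : Prop :=
  ∀ ε > 0, ∃ δ > 0, ∀ (n : ℕ) (p : ℕ → ℝ), p 0 = a → p n = b →
    (∀ i < n, p i ≤ p (i + 1)) → (∀ i < n, p (i + 1) - p i < δ) →
    |(∑ i ∈ Finset.range n, y (p i) * (x (p (i + 1)) - x (p i))) - I| < ε

section Solutions

variable {V H : Type*} [NormedAddCommGroup V] [NormedSpace ℝ V]
  [NormedAddCommGroup H] [InnerProductSpace ℝ H]

/-- `ut` is, along the path `ω`, a variational solution on `[τ, τ + T]` of the random PDE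
`d ũ(t) = z_t A(t, z_t⁻¹ ũ(t)) dt`, where `z_t = exp (-β ω_t)`, with initial value `utτ` at `τ`. -/
structure IsRandomPDESolution (ι : V →L[ℝ] H) (A : ℝ → V → StrongDual ℝ V) (β : ℝ) (ω : ℝ → ℝ)
    (α τ T : ℝ) (utτ : H) (ut : ℝ → H) : Prop where
  regular : IsContinuousLp ι α τ T ut
  integrable : ∀ v : V, IntervalIntegrable
    (fun r => Real.exp (-β * ω r) * A r (Real.exp (β * ω r) • toV ι (ut r)) v) volume τ (τ + T)
  equation : ∀ v : V, ∀ t ∈ Icc τ (τ + T),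
    ⟪ut t, ι v⟫ = ⟪utτ, ι v⟫
      + ∫ r in τ..t, Real.exp (-β * ω r) * A r (Real.exp (β * ω r) • toV ι (ut r)) v

/-- `u` is, along the path `ω`, a variational solution on `[τ, τ + T]` of the SPDE
`d u_t = A(t, u_t) dt + β u_t dω_t` with initial value `uτ` at `τ`. The stochastic integral is a
Young integral, with `⟨u(·), v⟩_H` being `γ₂`-Hölder continuous for all `v ∈ V`. -/
structure IsSPDESolution (ι : V →L[ℝ] H) (A : ℝ → V → StrongDual ℝ V) (β : ℝ) (ω : ℝ → ℝ)
    (γ₂ : ℝ≥0) (α τ T : ℝ) (uτ : H) (u : ℝ → H) : Prop where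
  regular : IsContinuousLp ι α τ T u
  holder : ∀ v : V, ∃ K : ℝ≥0, HolderOnWith K γ₂ (fun r => ⟪u r, ι v⟫) (Icc τ (τ + T))
  integrable : ∀ v : V,
    IntervalIntegrable (fun r => A r (toV ι (u r)) v) volume τ (τ + T)
  equation : ∀ v : V, ∀ t ∈ Icc τ (τ + T), ∃ I : ℝ,
    HasYoungIntegral (fun r => β * ⟪u r, ι v⟫) ω τ t I ∧
    ⟪u t, ι v⟫ = ⟪uτ, ι v⟫ + (∫ r in τ..t, A r (toV ι (u r)) v) + I

end Solutions

end FractionalSPDE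

end

/-!
The substitution `ũ = z u` with `z = exp (-β ω)` turns the equation driven by the rough path `ω`
into a random evolution equation without a stochastic integral. The continuous dependence on the
initial value is proved for the latter and transported back; the constant is a bound over the time
interval for `(z_τ / z_t)² = exp (2 β (ω_t - ω_τ))`.

*Random equation.* The embedding is injective and `V` is reflexive, so `V*` is separable
(`secondCountableTopology_dual`); the drift along a solution is then strongly measurable, and by the
growth condition it lies in `L^{α/(α-1)}` with values in `V*`. The difference `w` of two solutions
obeys the energy inequality `‖w t‖² - ‖w s‖² ≤ 2 ∫ ⟨w', w⟩` (`norm_sq_sub_norm_sq_le`). This half of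
the Lions–Magenes formula suffices; it follows by integrating
`‖w t‖² - ‖w (t - h)‖² ≤ 2 ⟪w t - w (t - h), w t⟫` over `t`, from the continuity of translations
in `L^q`. Local monotonicity survives the scaling by `z`, and Gronwall's inequality with an
integrable coefficient of arbitrary sign (`gronwall_of_integrable`) concludes.

*Change of variables.* Tested against `v ∈ V`, both equations are scalar, and the product rule for
`z⁻¹ ⟪ũ, v⟫` and `z ⟪u, v⟫` is checked interval by interval. A remainder of smaller order than the
increments of a monotone control (`IsNegligible`) has vanishing sums over partitions. The remainders
are: the second-order term of the exponential, of order `(t - s) ^ (2 γ₁)` with `2 γ₁ > 1`; the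
oscillation of a continuous function against an integrable one; and, in the passage from `u` to `ũ`,
the Young–Loève remainder of order `(t - s) ^ (γ₁ + γ₂)` (`HasYoungIntegral.abs_sub_sub_le`), which
is obtained from dyadic sums and the existence of the integral alone.
-/

namespace FractionalSPDE

/-! ### Negligible remainders -/

lemma partition_mem_Icc {a b : ℝ} {n : ℕ} {p : ℕ → ℝ} (h0 : p 0 = a) (hn : p n = b)
    (hp : ∀ i < n, p i ≤ p (i + 1)) : ∀ i ≤ n, p i ∈ Icc a b := by
  have hmono : ∀ i j, i ≤ j → j ≤ n → p i ≤ p j := by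
    intro i j hij
    induction j, hij using Nat.le_induction with
    | base => exact fun _ => le_rfl
    | succ j hj ih => exact fun hjn => (ih (by omega)).trans (hp j (by omega))
  exact fun i hi => ⟨h0 ▸ hmono 0 i (Nat.zero_le _) hi, hn ▸ hmono i n hi le_rfl⟩

/-- The two-parameter quantity `R s t` is, on `[a, b]`, of smaller order than the increments of the
control `m`, uniformly as `t - s → 0`. Its sums over partitions then tend to zero with the mesh. -/
def IsNegligible (m : ℝ → ℝ) (a b : ℝ) (R : ℝ → ℝ → ℝ) : Prop :=
  ∀ ε > 0, ∃ δ > 0, ∀ s ∈ Icc a b, ∀ t ∈ Icc a b, s ≤ t → t - s < δ →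
    |R s t| ≤ ε * (m t - m s)

namespace IsNegligible

variable {m : ℝ → ℝ} {a b : ℝ} {R S : ℝ → ℝ → ℝ}

lemma of_abs_le (hR : IsNegligible m a b R)
    (h : ∃ δ > 0, ∀ s ∈ Icc a b, ∀ t ∈ Icc a b, s ≤ t → t - s < δ → |S s t| ≤ |R s t|) :
    IsNegligible m a b S := by
  intro ε hε
  obtain ⟨δ, hδ, h1⟩ := hR ε hε
  obtain ⟨δ', hδ', h2⟩ := h
  refine ⟨min δ δ', lt_min hδ hδ', fun s hs t ht hst hd => ?_⟩
  exact (h2 s hs t ht hst (hd.trans_le (min_le_right _ _))).trans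
    (h1 s hs t ht hst (hd.trans_le (min_le_left _ _)))

lemma congr (hR : IsNegligible m a b R)
    (h : ∀ s ∈ Icc a b, ∀ t ∈ Icc a b, s ≤ t → S s t = R s t) : IsNegligible m a b S :=
  hR.of_abs_le ⟨1, one_pos, fun s hs t ht hst _ => by rw [h s hs t ht hst]⟩

lemma add (hR : IsNegligible m a b R) (hS : IsNegligible m a b S) :
    IsNegligible m a b (fun s t => R s t + S s t) := by
  intro ε hε
  obtain ⟨δ, hδ, h1⟩ := hR (ε / 2) (by positivity)
  obtain ⟨δ', hδ', h2⟩ := hS (ε / 2) (by positivity)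
  refine ⟨min δ δ', lt_min hδ hδ', fun s hs t ht hst hd => ?_⟩
  have e1 := h1 s hs t ht hst (hd.trans_le (min_le_left _ _))
  have e2 := h2 s hs t ht hst (hd.trans_le (min_le_right _ _))
  have e3 := abs_add_le (R s t) (S s t)
  linarith

lemma bounded_mul (hR : IsNegligible m a b R) {c : ℝ → ℝ → ℝ} {M : ℝ}
    (hc : ∀ s ∈ Icc a b, ∀ t ∈ Icc a b, |c s t| ≤ M) :
    IsNegligible m a b (fun s t => c s t * R s t) := by
  intro ε hε
  obtain ⟨δ, hδ, h1⟩ := hR (ε / (|M| + 1)) (by positivity)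
  refine ⟨δ, hδ, fun s hs t ht hst hd => ?_⟩
  have e1 := h1 s hs t ht hst hd
  have hM : |c s t| ≤ |M| + 1 := (hc s hs t ht).trans ((le_abs_self M).trans (by linarith))
  rw [abs_mul]
  calc |c s t| * |R s t| ≤ (|M| + 1) * (ε / (|M| + 1) * (m t - m s)) := by gcongr
    _ = ε * (m t - m s) := by field_simp

lemma neg (hR : IsNegligible m a b R) : IsNegligible m a b (fun s t => - R s t) :=
  hR.of_abs_le ⟨1, one_pos, fun s _ t _ _ _ => by rw [abs_neg]⟩

lemma mono_control (hR : IsNegligible m a b R) {m' : ℝ → ℝ}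
    (h : ∀ s ∈ Icc a b, ∀ t ∈ Icc a b, s ≤ t → m t - m s ≤ m' t - m' s) :
    IsNegligible m' a b R := by
  intro ε hε
  obtain ⟨δ, hδ, h1⟩ := hR ε hε
  exact ⟨δ, hδ, fun s hs t ht hst hd =>
    (h1 s hs t ht hst hd).trans (mul_le_mul_of_nonneg_left (h s hs t ht hst) hε.le)⟩

lemma mono_interval (hR : IsNegligible m a b R) {b' : ℝ} (hb : b' ≤ b) :
    IsNegligible m a b' R := by
  intro ε hε
  obtain ⟨δ, hδ, h1⟩ := hR ε hε
  exact ⟨δ, hδ, fun s hs t ht hst hd =>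
    h1 s ⟨hs.1, hs.2.trans hb⟩ t ⟨ht.1, ht.2.trans hb⟩ hst hd⟩

/-- A power `(t - s) ^ θ` with `θ > 1` is negligible for length. -/
lemma of_le_rpow {K θ : ℝ} (hθ : 1 < θ)
    (h : ∃ δ > 0, ∀ s ∈ Icc a b, ∀ t ∈ Icc a b, s ≤ t → t - s < δ →
      |R s t| ≤ K * (t - s) ^ θ) :
    IsNegligible id a b R := by
  intro ε hε
  obtain ⟨δ, hδ, h⟩ := h
  have hlim : Filter.Tendsto (fun x : ℝ => |K| * x ^ (θ - 1)) (𝓝 0) (𝓝 0) := by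
    have := (Real.continuousAt_rpow_const 0 (θ - 1) (Or.inr (by linarith))).tendsto.const_mul |K|
    simpa [Real.zero_rpow (by linarith : θ - 1 ≠ 0)] using this
  obtain ⟨δ', hδ', h'⟩ := Metric.eventually_nhds_iff.1 (hlim.eventually (gt_mem_nhds hε))
  refine ⟨min δ δ', lt_min hδ hδ', fun s hs t ht hst hd => ?_⟩
  have h0 : 0 ≤ t - s := sub_nonneg.2 hst
  have h2 : |K| * (t - s) ^ (θ - 1) < ε := h' (by
    rw [Real.dist_eq, sub_zero, abs_of_nonneg h0]
    exact hd.trans_le (min_le_right _ _))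
  have h3 : (t - s) ^ θ = (t - s) ^ (θ - 1) * (t - s) := by
    rcases h0.eq_or_lt with h0 | h0
    · rw [← h0, mul_zero, Real.zero_rpow (by linarith)]
    · rw [← Real.rpow_add_one h0.ne']; congr 1; ring
  calc |R s t| ≤ K * (t - s) ^ θ := h s hs t ht hst (hd.trans_le (min_le_left _ _))
    _ ≤ |K| * (t - s) ^ θ := by
      gcongr
      exact le_abs_self K
    _ = |K| * (t - s) ^ (θ - 1) * (t - s) := by rw [h3]; ring
    _ ≤ ε * (t - s) := by gcongr

/-- A quantity bounded by the oscillation of a continuous function times an increment of the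
control is negligible. -/
lemma of_osc {e : ℝ → ℝ} (he : ContinuousOn e (Icc a b))
    (h : ∀ s ∈ Icc a b, ∀ t ∈ Icc a b, s ≤ t → ∀ ε > 0,
      (∀ r ∈ Icc s t, ∀ r' ∈ Icc s t, |e r - e r'| ≤ ε) → |R s t| ≤ ε * (m t - m s)) :
    IsNegligible m a b R := by
  intro ε hε
  have hu := isCompact_Icc.uniformContinuousOn_of_continuous he
  obtain ⟨δ, hδ, h1⟩ := Metric.uniformContinuousOn_iff.1 hu ε hε
  refine ⟨δ, hδ, fun s hs t ht hst hd => h s hs t ht hst ε hε fun r hr r' hr' => ?_⟩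
  refine (h1 r ⟨hs.1.trans hr.1, hr.2.trans ht.2⟩ r' ⟨hs.1.trans hr'.1, hr'.2.trans ht.2⟩ ?_).le
  rw [Real.dist_eq]
  refine lt_of_le_of_lt (abs_sub_le_iff.2 ⟨?_, ?_⟩) hd <;> linarith [hr.1, hr.2, hr'.1, hr'.2]

/-- The sums of a negligible quantity over partitions tend to zero with the mesh. -/
lemma abs_sum_lt (hR : IsNegligible m a b R) (hm : m a ≤ m b) :
    ∀ ε > 0, ∃ δ > 0, ∀ (n : ℕ) (p : ℕ → ℝ), p 0 = a → p n = b →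
      (∀ i < n, p i ≤ p (i + 1)) → (∀ i < n, p (i + 1) - p i < δ) →
      |∑ i ∈ Finset.range n, R (p i) (p (i + 1))| < ε := by
  intro ε hε
  have hm' : 0 ≤ m b - m a := sub_nonneg.2 hm
  obtain ⟨δ, hδ, h⟩ := hR (ε / (m b - m a + 1)) (by positivity)
  refine ⟨δ, hδ, fun n p h0 hn hp hd => ?_⟩
  have hmem := partition_mem_Icc h0 hn hp
  calc |∑ i ∈ Finset.range n, R (p i) (p (i + 1))|
      ≤ ∑ i ∈ Finset.range n, |R (p i) (p (i + 1))| := Finset.abs_sum_le_sum_abs _ _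
    _ ≤ ∑ i ∈ Finset.range n, ε / (m b - m a + 1) * (m (p (i + 1)) - m (p i)) := by
        refine Finset.sum_le_sum fun i hi => ?_
        have hi := Finset.mem_range.1 hi
        exact h _ (hmem i hi.le) _ (hmem (i + 1) hi) (hp i hi) (hd i hi)
    _ = ε / (m b - m a + 1) * (m b - m a) := by
        rw [← Finset.mul_sum, Finset.sum_range_sub (fun i => m (p i)), h0, hn]
    _ < ε := by
        rw [div_mul_eq_mul_div, div_lt_iff₀ (by positivity)]
        nlinarith

end IsNegligible

/-- Uniform partitions of `[a, b]` with mesh below a given bound. -/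
lemma exists_uniform_partition {a b δ : ℝ} (hab : a ≤ b) (hδ : 0 < δ) :
    ∃ (n : ℕ) (p : ℕ → ℝ), p 0 = a ∧ p n = b ∧
      (∀ i < n, p i ≤ p (i + 1)) ∧ (∀ i < n, p (i + 1) - p i < δ) := by
  obtain ⟨n, hn⟩ := exists_nat_gt ((b - a) / δ)
  have hn0 : (0 : ℝ) < n := lt_of_le_of_lt (div_nonneg (sub_nonneg.2 hab) hδ.le) hn
  have hd : ∀ i : ℕ, (a + ((i + 1 : ℕ) : ℝ) * ((b - a) / n)) - (a + (i : ℝ) * ((b - a) / n))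
      = (b - a) / n := fun i => by push_cast; ring
  refine ⟨n, fun i => a + i * ((b - a) / n), by simp, ?_, fun i _ => ?_, fun i _ => ?_⟩
  · field_simp; ring
  · rw [← sub_nonneg, hd]; exact div_nonneg (sub_nonneg.2 hab) hn0.le
  · rw [hd, div_lt_iff₀ hn0]; rwa [div_lt_iff₀ hδ, mul_comm] at hn

/-- A function whose increments are bounded above by a negligible quantity does not increase. -/
lemma IsNegligible.le_of_sub_le {m D : ℝ → ℝ} {a b : ℝ} {R : ℝ → ℝ → ℝ}
    (hR : IsNegligible m a b R) (hab : a ≤ b) (hm : m a ≤ m b)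
    (h : ∀ s ∈ Icc a b, ∀ t ∈ Icc a b, s ≤ t → D t - D s ≤ R s t) : D b ≤ D a := by
  refine le_of_forall_pos_lt_add fun ε hε => ?_
  obtain ⟨δ, hδ, h1⟩ := hR.abs_sum_lt hm ε hε
  obtain ⟨n, p, h0, hn, hp, hd⟩ := exists_uniform_partition hab hδ
  have hmem := partition_mem_Icc h0 hn hp
  have h2 : D b - D a ≤ ∑ i ∈ Finset.range n, R (p i) (p (i + 1)) := by
    rw [← h0, ← hn, ← Finset.sum_range_sub (fun i => D (p i))]
    refine Finset.sum_le_sum fun i hi => ?_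
    have hi := Finset.mem_range.1 hi
    exact h _ (hmem i hi.le) _ (hmem (i + 1) hi) (hp i hi)
  linarith [(abs_lt.1 (h1 n p h0 hn hp hd)).2]

lemma IsNegligible.eq_of_sub_eq {m D : ℝ → ℝ} {a b : ℝ}
    (hR : IsNegligible m a b fun s t => D t - D s) (hab : a ≤ b) (hm : m a ≤ m b) :
    D b = D a := by
  refine le_antisymm (hR.le_of_sub_le hab hm fun s _ t _ _ => le_rfl) ?_
  have := hR.neg.le_of_sub_le (D := fun t => - D t) hab hm fun s _ t _ _ => by
    linarith
  linarith

/-- The control `t + ∫_a^t |ψ|`: it dominates both length and increments of the primitive of `ψ`. -/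
noncomputable def control (a : ℝ) (ψ : ℝ → ℝ) (t : ℝ) : ℝ := t + ∫ r in a..t, |ψ r|

lemma intervalIntegrable_of_mem {E : Type*} [NormedAddCommGroup E] {ψ : ℝ → E} {a b s t : ℝ}
    (hψ : IntervalIntegrable ψ volume a b) (hs : s ∈ Icc a b) (ht : t ∈ Icc a b) :
    IntervalIntegrable ψ volume s t := by
  have hab : a ≤ b := hs.1.trans hs.2
  refine hψ.mono_set ?_
  rw [uIcc_of_le hab]
  exact uIcc_subset_Icc hs ht

lemma control_sub {a b : ℝ} {ψ : ℝ → ℝ} (hψ : IntervalIntegrable ψ volume a b)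
    {s t : ℝ} (hs : s ∈ Icc a b) (ht : t ∈ Icc a b) :
    control a ψ t - control a ψ s = (t - s) + ∫ r in s..t, |ψ r| := by
  have ha : a ∈ Icc a b := ⟨le_rfl, hs.1.trans hs.2⟩
  have h := intervalIntegral.integral_interval_sub_left (intervalIntegrable_of_mem hψ.abs ha ht)
    (intervalIntegrable_of_mem hψ.abs ha hs)
  simp only [control]
  linarith

lemma control_le {a b : ℝ} {ψ : ℝ → ℝ} (hψ : IntervalIntegrable ψ volume a b)
    {s t : ℝ} (hs : s ∈ Icc a b) (ht : t ∈ Icc a b) (hst : s ≤ t) :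
    control a ψ s ≤ control a ψ t := by
  have h := control_sub hψ hs ht
  have h2 := intervalIntegral.integral_nonneg (μ := volume) hst fun r _ => abs_nonneg (ψ r)
  linarith

namespace IsNegligible

variable {a b : ℝ} {ψ : ℝ → ℝ} {R : ℝ → ℝ → ℝ}

lemma control_of_id (hR : IsNegligible id a b R) (hψ : IntervalIntegrable ψ volume a b) :
    IsNegligible (control a ψ) a b R :=
  hR.mono_control fun s hs t ht hst => by
    rw [control_sub hψ hs ht]
    have := intervalIntegral.integral_nonneg (μ := volume) hst fun r _ => abs_nonneg (ψ r)
    simp only [id]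
    linarith

/-- The integral over `[s, t]` of `ψ` times an increment inside `[s, t]` of a continuous function is
negligible. -/
lemma of_integral {e : ℝ → ℝ} (he : ContinuousOn e (Icc a b))
    (hψ : IntervalIntegrable ψ volume a b) {F : ℝ → ℝ → ℝ → ℝ}
    (hF : ∀ s t r, r ∈ Icc s t → ∃ r' ∈ Icc s t, |F s t r| ≤ |e r' - e r| * |ψ r|) :
    IsNegligible (control a ψ) a b fun s t => ∫ r in s..t, F s t r := by
  refine of_osc he fun s hs t ht hst ε hε hosc => ?_
  rw [control_sub hψ hs ht]
  have hi := (intervalIntegrable_of_mem hψ hs ht).abs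
  have h1 : ‖∫ r in s..t, F s t r‖ ≤ ∫ r in s..t, ε * |ψ r| := by
    refine intervalIntegral.norm_integral_le_of_norm_le hst
      (Filter.Eventually.of_forall fun r hr => ?_) (hi.const_mul ε)
    have hr' := Ioc_subset_Icc_self hr
    obtain ⟨r', hr'', h⟩ := hF s t r hr'
    exact h.trans (mul_le_mul_of_nonneg_right (hosc _ hr'' _ hr') (abs_nonneg _))
  rw [intervalIntegral.integral_const_mul] at h1
  rw [← Real.norm_eq_abs, mul_add]
  have : 0 ≤ ε * (t - s) := mul_nonneg hε.le (sub_nonneg.2 hst)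
  linarith

/-- First-order Taylor expansion of the exponential along a path whose squared increments are
negligible. -/
lemma exp_taylor {m x : ℝ → ℝ} (hx : ContinuousOn x (Icc a b))
    (h : IsNegligible m a b fun s t => (x t - x s) ^ 2) :
    IsNegligible m a b fun s t => Real.exp (x t - x s) - 1 - (x t - x s) := by
  refine h.of_abs_le ?_
  have hu := isCompact_Icc.uniformContinuousOn_of_continuous hx
  obtain ⟨δ, hδ, h1⟩ := Metric.uniformContinuousOn_iff.1 hu 1 one_pos
  refine ⟨δ, hδ, fun s hs t ht hst hd => ?_⟩
  rw [abs_of_nonneg (sq_nonneg (x t - x s))]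
  refine Real.abs_exp_sub_one_sub_id_le (h1 t ht s hs ?_).le
  rwa [Real.dist_eq, abs_of_nonneg (sub_nonneg.2 hst)]

end IsNegligible

/-! ### Gronwall's inequality with an integrable coefficient of arbitrary sign -/

lemma continuousOn_primitive {a b : ℝ} {k : ℝ → ℝ} (hab : a ≤ b)
    (hk : IntervalIntegrable k volume a b) :
    ContinuousOn (fun t => ∫ r in a..t, k r) (Icc a b) := by
  have := intervalIntegral.continuousOn_primitive_interval (f := k) (a := a) (b := b)
    (μ := volume) (by
      rw [uIcc_of_le hab]
      exact (intervalIntegrable_iff_integrableOn_Icc_of_le hab).1 hk)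
  rwa [uIcc_of_le hab] at this

/-- If `y t - y s ≤ ∫_s^t k y` for all `s ≤ t`, then `y b ≤ exp (∫_a^b k) y a`; the coefficient `k`
may change sign. The increments of `exp (-∫_a^t k) y t` are bounded by a negligible quantity. -/
theorem gronwall_of_integrable {a b : ℝ} {k y : ℝ → ℝ} (hab : a ≤ b)
    (hk : IntervalIntegrable k volume a b) (hy : ContinuousOn y (Icc a b))
    (h : ∀ s ∈ Icc a b, ∀ t ∈ Icc a b, s ≤ t → y t - y s ≤ ∫ r in s..t, k r * y r) :
    y b ≤ Real.exp (∫ r in a..b, k r) * y a := by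
  have hK := continuousOn_primitive hab hk
  set K : ℝ → ℝ := fun t => ∫ r in a..t, k r with hKdef
  have ha : a ∈ Icc a b := ⟨le_rfl, hab⟩
  have hb : b ∈ Icc a b := ⟨hab, le_rfl⟩
  have hKsub : ∀ s ∈ Icc a b, ∀ t ∈ Icc a b, K t - K s = ∫ r in s..t, k r := fun s hs t ht =>
    intervalIntegral.integral_interval_sub_left (intervalIntegrable_of_mem hk ha ht)
      (intervalIntegrable_of_mem hk ha hs)
  obtain ⟨M, hM⟩ := isCompact_Icc.exists_bound_of_continuousOn hy
  obtain ⟨N, hN⟩ := isCompact_Icc.exists_bound_of_continuousOn hK.neg.rexp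
  -- the two remainders: freezing `y` at the left end point, and linearising the exponential
  have r1 : IsNegligible (control a k) a b fun s t => ∫ r in s..t, k r * (y r - y s) :=
    IsNegligible.of_integral hy hk fun s t r hr =>
      ⟨s, ⟨le_rfl, hr.1.trans hr.2⟩, by rw [abs_mul, mul_comm, abs_sub_comm]⟩
  have r2 : IsNegligible (control a k) a b fun s t => (K t - K s) ^ 2 := by
    refine IsNegligible.of_osc hK fun s hs t ht hst ε hε hosc => ?_
    rw [control_sub hk hs ht, abs_of_nonneg (sq_nonneg _), ← sq_abs, pow_two]
    have h1 := hosc t ⟨hst, le_rfl⟩ s ⟨le_rfl, hst⟩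
    have h2 : |K t - K s| ≤ ∫ r in s..t, |k r| := by
      rw [hKsub s hs t ht]; exact intervalIntegral.abs_integral_le_integral_abs hst
    have h3 : 0 ≤ t - s := sub_nonneg.2 hst
    have h4 := abs_nonneg (K t - K s)
    calc |K t - K s| * |K t - K s| ≤ ε * ∫ r in s..t, |k r| := mul_le_mul h1 h2 h4 hε.le
      _ ≤ _ := by gcongr; linarith
  have r3 := IsNegligible.exp_taylor hK r2
  have r4 := (r1.bounded_mul (c := fun s t => Real.exp (-K t)) (M := N)
    fun s _ t ht => by simpa using hN t ht).add (r3.bounded_mul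
      (c := fun s t => -(y s * Real.exp (-K t))) (M := M * N) fun s hs t ht => by
        rw [abs_neg, abs_mul]
        exact mul_le_mul (hM s hs) (hN t ht) (abs_nonneg _) ((norm_nonneg _).trans (hM s hs)))
  have key := r4.le_of_sub_le (D := fun t => Real.exp (-K t) * y t) hab
    (control_le hk ha hb hab) fun s hs t ht hst => by
      have i1 := (intervalIntegrable_of_mem hk hs ht)
      have i2 : IntervalIntegrable (fun r => k r * y r) volume s t :=
        i1.mul_continuousOn (hy.mono (uIcc_subset_Icc hs ht))
      have e1 : ∫ r in s..t, k r * (y r - y s) = (∫ r in s..t, k r * y r) - (K t - K s) * y s := by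
        rw [hKsub s hs t ht, ← intervalIntegral.integral_mul_const,
          ← intervalIntegral.integral_sub i2 (i1.mul_const _)]
        congr 1; ext r; ring
      have e2 : Real.exp (-K s) = Real.exp (-K t) * Real.exp (K t - K s) := by
        rw [← Real.exp_add]; congr 1; ring
      have e3 := mul_le_mul_of_nonneg_left (h s hs t ht hst) (Real.exp_pos (-K t)).le
      rw [e1, e2]
      linear_combination e3
  have hKa : K a = 0 := intervalIntegral.integral_same
  simp only [hKa, neg_zero, Real.exp_zero, one_mul] at key
  calc y b = Real.exp (K b) * (Real.exp (-K b) * y b) := by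
        rw [← mul_assoc, ← Real.exp_add]; simp
    _ ≤ Real.exp (K b) * y a := mul_le_mul_of_nonneg_left key (Real.exp_pos _).le

/-! ### Young integrals -/

lemma hasYoungIntegral_of_isNegligible {m y x J : ℝ → ℝ} {a b : ℝ}
    (h : IsNegligible m a b fun s t => y s * (x t - x s) - (J t - J s)) (hm : m a ≤ m b) :
    HasYoungIntegral y x a b (J b - J a) := by
  intro ε hε
  obtain ⟨δ, hδ, h1⟩ := h.abs_sum_lt hm ε hε
  refine ⟨δ, hδ, fun n p h0 hn hp hd => ?_⟩
  have := h1 n p h0 hn hp hd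
  rwa [Finset.sum_sub_distrib, Finset.sum_range_sub (fun i => J (p i)), h0, hn] at this

lemma HasYoungIntegral.eq_zero {y x : ℝ → ℝ} {a I : ℝ} (h : HasYoungIntegral y x a a I) :
    I = 0 := by
  by_contra hI
  obtain ⟨δ, hδ, h1⟩ := h |I| (abs_pos.2 hI)
  have := h1 0 (fun _ => a) rfl rfl (by simp) (by simp)
  simp at this

/-- The left-point sum of `y dx` over the partition of `[s, t]` into `n` intervals of equal
length. -/
noncomputable def uniformSum (y x : ℝ → ℝ) (s t : ℝ) (n : ℕ) : ℝ :=
  ∑ i ∈ Finset.range n, y (s + i * ((t - s) / n)) *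
    (x (s + (i + 1 : ℕ) * ((t - s) / n)) - x (s + i * ((t - s) / n)))

lemma sum_range_two_mul (f : ℕ → ℝ) (n : ℕ) :
    ∑ i ∈ Finset.range (2 * n), f i = ∑ i ∈ Finset.range n, (f (2 * i) + f (2 * i + 1)) := by
  induction n with
  | zero => simp
  | succ n ih =>
    rw [Finset.sum_range_succ, ← ih, show 2 * (n + 1) = 2 * n + 1 + 1 by ring,
      Finset.sum_range_succ, Finset.sum_range_succ]
    ring

section YoungLoeve

variable {y x : ℝ → ℝ} {a b K₁ K₂ γ₁ γ₂ : ℝ}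

/-- Halving the mesh changes the left-point sum by the sum of the products of the increments of `y`
and `x` over the two halves of each interval. -/
lemma abs_uniformSum_two_mul_sub_le
    (hx : ∀ s ∈ Icc a b, ∀ t ∈ Icc a b, |x s - x t| ≤ K₁ * |s - t| ^ γ₁)
    (hy : ∀ s ∈ Icc a b, ∀ t ∈ Icc a b, |y s - y t| ≤ K₂ * |s - t| ^ γ₂)
    {s t : ℝ} (hs : s ∈ Icc a b) (ht : t ∈ Icc a b) (hst : s < t) {n : ℕ} (hn : 0 < n) :
    |uniformSum y x s t (2 * n) - uniformSum y x s t n| ≤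
      n * (K₁ * K₂ * ((t - s) / (2 * n)) ^ (γ₁ + γ₂)) := by
  have hn' : (0 : ℝ) < n := by exact_mod_cast hn
  have hts : 0 < t - s := sub_pos.2 hst
  set h := (t - s) / (2 * n) with hh
  have hpos : 0 < h := by positivity
  have h2 : (t - s) / n = 2 * h := by rw [hh]; field_simp
  have hend : s + 2 * n * h = t := by rw [hh]; field_simp; ring
  have hmem : ∀ u : ℝ, 0 ≤ u → u ≤ 2 * n → s + u * h ∈ Icc a b := fun u hu hun => by
    have h3 : u * h ≤ 2 * n * h := mul_le_mul_of_nonneg_right hun hpos.le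
    have h4 : 0 ≤ u * h := by positivity
    constructor <;> linarith [hs.1, ht.2]
  have heq : uniformSum y x s t (2 * n) - uniformSum y x s t n =
      ∑ i ∈ Finset.range n, (y (s + (2 * i + 1) * h) - y (s + (2 * i) * h)) *
        (x (s + (2 * i + 2) * h) - x (s + (2 * i + 1) * h)) := by
    rw [uniformSum, uniformSum, sum_range_two_mul, ← Finset.sum_sub_distrib]
    refine Finset.sum_congr rfl fun i _ => ?_
    push_cast
    rw [h2, ← hh]
    have e1 : s + (i : ℝ) * (2 * h) = s + 2 * i * h := by ring
    have e2 : s + ((i : ℝ) + 1) * (2 * h) = s + (2 * i + 2) * h := by ring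
    have e3 : s + (2 * (i : ℝ) + 1 + 1) * h = s + (2 * i + 2) * h := by ring
    rw [e1, e2, e3]
    ring
  rw [heq]
  calc _ ≤ ∑ i ∈ Finset.range n, |(y (s + (2 * i + 1) * h) - y (s + (2 * i) * h)) *
        (x (s + (2 * i + 2) * h) - x (s + (2 * i + 1) * h))| := Finset.abs_sum_le_sum_abs _ _
    _ ≤ ∑ i ∈ Finset.range n, K₁ * K₂ * h ^ (γ₁ + γ₂) := by
        refine Finset.sum_le_sum fun i hi => ?_
        have hi : (i : ℝ) + 1 ≤ n := by exact_mod_cast Finset.mem_range.1 hi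
        have hi0 : (0 : ℝ) ≤ i := Nat.cast_nonneg i
        have m0 := hmem (2 * i) (by linarith) (by linarith)
        have m1 := hmem (2 * i + 1) (by linarith) (by linarith)
        have m2 := hmem (2 * i + 2) (by linarith) (by linarith)
        have b1 := hy _ m1 _ m0
        have b2 := hx _ m2 _ m1
        rw [show s + (2 * (i : ℝ) + 1) * h - (s + 2 * i * h) = h by ring, abs_of_pos hpos] at b1
        rw [show s + (2 * (i : ℝ) + 2) * h - (s + (2 * i + 1) * h) = h by ring,
          abs_of_pos hpos] at b2
        rw [abs_mul, Real.rpow_add hpos]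
        calc _ ≤ (K₂ * h ^ γ₂) * (K₁ * h ^ γ₁) :=
              mul_le_mul b1 b2 (abs_nonneg _) ((abs_nonneg _).trans b1)
          _ = _ := by ring
    _ = _ := by simp

/-- The dyadic left-point sums stay within a multiple of `(t - s) ^ (γ₁ + γ₂)` of the one-term sum,
because the successive differences form a geometric series. -/
lemma abs_uniformSum_sub_le (hK₁ : 0 ≤ K₁) (hK₂ : 0 ≤ K₂) (hγ : 1 < γ₁ + γ₂)
    (hx : ∀ s ∈ Icc a b, ∀ t ∈ Icc a b, |x s - x t| ≤ K₁ * |s - t| ^ γ₁)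
    (hy : ∀ s ∈ Icc a b, ∀ t ∈ Icc a b, |y s - y t| ≤ K₂ * |s - t| ^ γ₂)
    {s t : ℝ} (hs : s ∈ Icc a b) (ht : t ∈ Icc a b) (hst : s < t) (n : ℕ) :
    |uniformSum y x s t (2 ^ n) - y s * (x t - x s)| ≤
      K₁ * K₂ / (1 - 2 ^ (1 - (γ₁ + γ₂))) * (t - s) ^ (γ₁ + γ₂) := by
  set θ := γ₁ + γ₂ with hθ
  set q : ℝ := 2 ^ (1 - θ) with hq
  have hts : 0 < t - s := sub_pos.2 hst
  have hq0 : 0 < q := by positivity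
  have hq1 : q < 1 := Real.rpow_lt_one_of_one_lt_of_neg one_lt_two (by linarith)
  have hstep : ∀ k : ℕ, |uniformSum y x s t (2 ^ (k + 1)) - uniformSum y x s t (2 ^ k)| ≤
      K₁ * K₂ * (t - s) ^ θ * q ^ k := by
    intro k
    have h1 := abs_uniformSum_two_mul_sub_le hx hy hs ht hst (n := 2 ^ k) (by positivity)
    rw [pow_succ']
    refine h1.trans ?_
    push_cast
    rw [← hθ, ← pow_succ', Real.div_rpow hts.le (by positivity)]
    have e1 : ((2 : ℝ) ^ (k + 1)) ^ θ = (2 ^ θ) ^ (k + 1) := by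
      rw [← Real.rpow_natCast, ← Real.rpow_mul (by norm_num), mul_comm, Real.rpow_mul (by norm_num),
        Real.rpow_natCast]
    have e2 : q = 2 / 2 ^ θ := by rw [hq, Real.rpow_sub two_pos, Real.rpow_one]
    have e3 : (1 : ℝ) ≤ 2 ^ θ := Real.one_le_rpow one_le_two (by linarith)
    rw [e1, e2, div_pow]
    have e4 : (0 : ℝ) < (2 ^ θ) ^ k := by positivity
    calc (2 : ℝ) ^ k * (K₁ * K₂ * ((t - s) ^ θ / (2 ^ θ) ^ (k + 1)))
        ≤ (2 : ℝ) ^ k * (K₁ * K₂ * ((t - s) ^ θ / (2 ^ θ) ^ k)) := by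
          gcongr
          exact Nat.le_succ k
      _ = _ := by ring
  have hsum : ∀ n : ℕ, |uniformSum y x s t (2 ^ n) - y s * (x t - x s)| ≤
      ∑ k ∈ Finset.range n, K₁ * K₂ * (t - s) ^ θ * q ^ k := by
    intro n
    induction n with
    | zero => simp [uniformSum]
    | succ n ih =>
      rw [Finset.sum_range_succ]
      have := abs_sub_le (uniformSum y x s t (2 ^ (n + 1))) (uniformSum y x s t (2 ^ n))
        (y s * (x t - x s))
      linarith [hstep n]
  refine (hsum n).trans ?_
  rw [← Finset.mul_sum]
  have h1 : ∑ k ∈ Finset.range n, q ^ k ≤ 1 / (1 - q) := by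
    rw [geom_sum_eq hq1.ne, ← neg_div_neg_eq]
    have : 0 ≤ q ^ n := by positivity
    have h2 : 0 < 1 - q := by linarith
    rw [neg_sub, neg_sub]
    gcongr
    linarith
  calc K₁ * K₂ * (t - s) ^ θ * ∑ k ∈ Finset.range n, q ^ k
      ≤ K₁ * K₂ * (t - s) ^ θ * (1 / (1 - q)) := by gcongr
    _ = _ := by ring

/-- **Young–Loève estimate**: for Hölder continuous `x, y` with exponents of sum greater than one,
the increment of the Young integral over `[s, t]` is `y s (x t - x s)` up to an error of order
`(t - s) ^ (γ₁ + γ₂)`. -/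
theorem HasYoungIntegral.abs_sub_sub_le (hK₁ : 0 ≤ K₁) (hK₂ : 0 ≤ K₂) (hγ : 1 < γ₁ + γ₂)
    (hx : ∀ s ∈ Icc a b, ∀ t ∈ Icc a b, |x s - x t| ≤ K₁ * |s - t| ^ γ₁)
    (hy : ∀ s ∈ Icc a b, ∀ t ∈ Icc a b, |y s - y t| ≤ K₂ * |s - t| ^ γ₂)
    {s t I J : ℝ} (hs : s ∈ Icc a b) (ht : t ∈ Icc a b) (hst : s ≤ t)
    (hI : HasYoungIntegral y x a s I) (hJ : HasYoungIntegral y x a t J) :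
    |J - I - y s * (x t - x s)| ≤
      K₁ * K₂ / (1 - 2 ^ (1 - (γ₁ + γ₂))) * (t - s) ^ (γ₁ + γ₂) := by
  refine le_of_forall_pos_le_add fun ε hε => ?_
  obtain ⟨δ₁, hδ₁, h1⟩ := hI (ε / 2) (by positivity)
  obtain ⟨δ₂, hδ₂, h2⟩ := hJ (ε / 2) (by positivity)
  obtain ⟨N, p, hp0, hpN, hp, hpd⟩ := exists_uniform_partition hs.1 (lt_min hδ₁ hδ₂)
  have hI' := h1 N p hp0 hpN hp fun i hi => (hpd i hi).trans_le (min_le_left _ _)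
  rcases hst.eq_or_lt with rfl | hst
  · have hJ' := h2 N p hp0 hpN hp fun i hi => (hpd i hi).trans_le (min_le_right _ _)
    rw [sub_self, sub_self, mul_zero, sub_zero, Real.zero_rpow (by linarith), mul_zero, zero_add]
    rw [abs_lt] at hI' hJ'
    rw [abs_le]
    constructor <;> linarith
  obtain ⟨n, hn⟩ := pow_unbounded_of_one_lt ((t - s) / δ₂) (one_lt_two : (1 : ℝ) < 2)
  have hts : 0 < t - s := sub_pos.2 hst
  -- the partition `p` of `[a, s]` followed by the dyadic partition of `[s, t]`
  let q : ℕ → ℝ := fun i => if i ≤ N then p i else s + (i - N : ℕ) * ((t - s) / (2 ^ n : ℕ))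
  have hq1 : ∀ i ≤ N, q i = p i := fun i hi => if_pos hi
  have hq2 : ∀ j, q (N + j) = s + j * ((t - s) / (2 ^ n : ℕ)) := fun j => by
    rcases Nat.eq_zero_or_pos j with rfl | hj
    · simp [q, hpN]
    · simp only [q]
      rw [if_neg (by omega), Nat.add_sub_cancel_left]
  have hstep : ∀ j, q (N + j + 1) - q (N + j) = (t - s) / (2 ^ n : ℕ) := fun j => by
    rw [add_assoc, hq2, hq2]; push_cast; ring
  have hqs : ∀ i < N + 2 ^ n, 0 ≤ q (i + 1) - q i ∧ q (i + 1) - q i < δ₂ := by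
    intro i _
    by_cases hi : i < N
    · rw [hq1 i hi.le, hq1 (i + 1) hi]
      exact ⟨sub_nonneg.2 (hp i hi), (hpd i hi).trans_le (min_le_right _ _)⟩
    · obtain ⟨j, rfl⟩ := Nat.exists_eq_add_of_le (not_lt.1 hi)
      rw [hstep]
      refine ⟨by positivity, ?_⟩
      push_cast
      rw [div_lt_iff₀ (by positivity)]
      rwa [div_lt_iff₀ hδ₂, mul_comm] at hn
  have hJ' := h2 (N + 2 ^ n) q (by rw [hq1 0 (Nat.zero_le _), hp0])
    (by rw [hq2]; push_cast; field_simp; ring) (fun i hi => sub_nonneg.1 (hqs i hi).1)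
    fun i hi => (hqs i hi).2
  have hsplit : ∑ i ∈ Finset.range (N + 2 ^ n), y (q i) * (x (q (i + 1)) - x (q i)) =
      (∑ i ∈ Finset.range N, y (p i) * (x (p (i + 1)) - x (p i))) +
        uniformSum y x s t (2 ^ n) := by
    rw [Finset.sum_range_add, uniformSum]
    congr 1
    · refine Finset.sum_congr rfl fun i hi => ?_
      have hi := Finset.mem_range.1 hi
      rw [hq1 i hi.le, hq1 (i + 1) hi]
    · refine Finset.sum_congr rfl fun i _ => ?_
      rw [add_assoc, hq2, hq2]
  rw [hsplit] at hJ'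
  have hd := abs_uniformSum_sub_le hK₁ hK₂ hγ hx hy hs ht hst n
  rw [abs_lt] at hI' hJ'
  rw [abs_le] at hd ⊢
  constructor <;> linarith

end YoungLoeve

/-! ### The energy inequality in a Gelfand triple -/

section Energy

variable {V H E : Type*} [NormedAddCommGroup V] [NormedSpace ℝ V]
  [NormedAddCommGroup H] [InnerProductSpace ℝ H]
  [NormedAddCommGroup E] [NormedSpace ℝ E] (B : E →L[ℝ] V →L[ℝ] ℝ)

/-- Continuity of translations in `L^q` makes the correlation of an `L^q` and an `L^p` function
continuous. -/
lemma continuous_integral_translate {p q : ENNReal} [Fact (1 ≤ p)] [Fact (1 ≤ q)]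
    [Fact (q ≠ ⊤)] [q.HolderConjugate p] {Φ : ℝ → E} {W : ℝ → V}
    (hΦ : MemLp Φ q) (hW : MemLp W p) :
    Continuous fun σ : ℝ => ∫ t, B (Φ (t - σ)) (W t) := by
  have h : (fun σ : ℝ => ∫ t, B (Φ (t - σ)) (W t)) = fun σ : ℝ =>
      B.lpPairing volume q p
        (DomAddAct.mk (-σ) +ᵥ hΦ.toLp Φ) (hW.toLp W) := by
    ext σ
    rw [ContinuousLinearMap.lpPairing_eq_integral, DomAddAct.mk_vadd_toLp]
    refine integral_congr_ae ?_
    filter_upwards [hW.coeFn_toLp,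
      (hΦ.comp_measurePreserving (measurePreserving_vadd (-σ) volume)).coeFn_toLp] with t h1 h2
    simp only [Function.comp_def] at h2
    rw [h1, h2]
    simp [sub_eq_neg_add]
  rw [h]
  have h1 : Continuous fun σ : ℝ => DomAddAct.mk (-σ) +ᵥ hΦ.toLp Φ :=
    (DomAddAct.continuous_mk.comp continuous_neg).vadd continuous_const
  fun_prop

/-- Joint integrability in the shift and in time, for the use of Fubini's theorem. -/
lemma integrable_translate_prod {Φ : ℝ → E} {W : ℝ → V}
    (hΦ : Integrable Φ) (hW : Integrable W) :
    Integrable (fun x : ℝ × ℝ => B (Φ (x.2 - x.1)) (W x.2)) (volume.prod volume) := by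
  have h := hW.convolution_integrand B.flip
    (hΦ.comp_neg)
  simpa using h

/-- **Energy inequality.** If `w` is continuous in `H`, lies in `L^p(a, b; V)` and has weak
derivative `Φ ∈ L^q(a, b; E)`, where `E` is paired with `V` by `B` (the case of interest being
`E = V*`), then `‖w b‖² - ‖w a‖² ≤ 2 ∫ B(Φ, w)`. For a shift `h > 0` one has
`‖w t‖² - ‖w (t - h)‖² ≤ 2 ⟪w t - w (t - h), w t⟫ = 2 ∫_{t-h}^t B(Φ r, w t) dr`; integrating in `t`,
dividing by `h` and letting `h → 0` gives the claim. -/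
theorem norm_sq_sub_norm_sq_le {ι : V →L[ℝ] H} {p q : ENNReal} [Fact (1 ≤ p)] [Fact (1 ≤ q)]
    [Fact (q ≠ ⊤)] [q.HolderConjugate p] {Φ : ℝ → E} {W : ℝ → V} {w : ℝ → H} {a b : ℝ}
    (hab : a ≤ b) (hΦ : MemLp Φ q (volume.restrict (Ioc a b)))
    (hW : MemLp W p (volume.restrict (Ioc a b))) (hw : ContinuousOn w (Icc a b))
    (hwW : ∀ᵐ t ∂volume.restrict (Ioc a b), w t = ι (W t))
    (heq : ∀ v, ∀ s ∈ Icc a b, ∀ t ∈ Icc a b, s ≤ t →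
      ⟪w t, ι v⟫ - ⟪w s, ι v⟫ = ∫ r in s..t, B (Φ r) v) :
    ‖w b‖ ^ 2 - ‖w a‖ ^ 2 ≤ 2 * ∫ r in a..b, B (Φ r) (W r) := by
  set Φ' := (Ioc a b).indicator Φ with hΦ'def
  set W' := (Ioc a b).indicator W with hW'def
  have hΦ' : MemLp Φ' q := (memLp_indicator_iff_restrict measurableSet_Ioc).2 hΦ
  have hW' : MemLp W' p := (memLp_indicator_iff_restrict measurableSet_Ioc).2 hW
  have hΦ1 : Integrable Φ' := (integrable_indicator_iff measurableSet_Ioc).2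
    (hΦ.integrable (Fact.out : 1 ≤ q))
  have hW1 : Integrable W' := (integrable_indicator_iff measurableSet_Ioc).2
    (hW.integrable (Fact.out : 1 ≤ p))
  set c : ℝ → ℝ := fun σ => ∫ t, B (Φ' (t - σ)) (W' t) with hcdef
  have hc : Continuous c := continuous_integral_translate B hΦ' hW'
  -- `w` is continued by its boundary values
  set y : ℝ → ℝ := fun t => ‖w (max a (min b t))‖ ^ 2 with hydef
  have hy : Continuous y := by
    refine ((hw.comp_continuous (by fun_prop) fun t => ?_).norm).pow 2
    exact ⟨le_max_left _ _, max_le hab (min_le_left _ _)⟩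
  have hpoint : ∀ h > 0, ∀ᵐ t ∂volume.restrict (Ioc a b),
      y t - y (t - h) ≤ 2 * ∫ σ in (0 : ℝ)..h, B (Φ' (t - σ)) (W' t) := by
    intro h hh
    filter_upwards [hwW, ae_restrict_mem measurableSet_Ioc] with t ht1 ht
    have hyt : y t = ‖w t‖ ^ 2 := by simp only [hydef, min_eq_right ht.2, max_eq_right ht.1.le]
    have hyh : y (t - h) = ‖w (max a (t - h))‖ ^ 2 := by
      simp only [hydef, min_eq_right (by linarith [ht.2] : t - h ≤ b)]
    have hst : max a (t - h) ≤ t := max_le ht.1.le (by linarith)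
    have hW't : W' t = W t := indicator_of_mem ht W
    have h1 := heq (W t) (max a (t - h)) ⟨le_max_left _ _, hst.trans ht.2⟩ t ⟨ht.1.le, ht.2⟩ hst
    have h2 : ∫ σ in (0 : ℝ)..h, B (Φ' (t - σ)) (W' t) =
        ∫ r in (max a (t - h))..t, B (Φ r) (W t) := by
      rw [intervalIntegral.integral_comp_sub_left (fun r => B (Φ' r) (W' t)), hW't, sub_zero,
        intervalIntegral.integral_of_le (by linarith), intervalIntegral.integral_of_le hst]
      have e1 : (fun r => B (Φ' r) (W t)) = (Ioc a b).indicator fun r => B (Φ r) (W t) := by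
        ext r
        by_cases hr : r ∈ Ioc a b <;> simp [hΦ'def, hr]
      rw [e1, setIntegral_indicator measurableSet_Ioc, Ioc_inter_Ioc, min_eq_left ht.2, max_comm]
    rw [h2, ← h1, hyt, hyh, ← ht1]
    have h3 := norm_sub_sq_real (w t) (w (max a (t - h)))
    have h4 := sq_nonneg ‖w t - w (max a (t - h))‖
    have h5 := real_inner_comm (w t) (w (max a (t - h)))
    rw [real_inner_self_eq_norm_sq]
    linarith
  have hint := integrable_translate_prod B hΦ1 hW1
  have hineq : ∀ h > 0, (∫ t in (b - h)..b, y t) - (∫ t in (a - h)..a, y t) ≤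
      2 * ∫ σ in (0 : ℝ)..h, c σ := by
    intro h hh
    have hyh : Continuous fun t => y (t - h) := by fun_prop
    have hres : Integrable (Function.uncurry fun σ t : ℝ => B (Φ' (t - σ)) (W' t))
        ((volume.restrict (Ioc 0 h)).prod (volume.restrict (Ioc a b))) := by
      rw [Measure.prod_restrict]
      exact hint.integrableOn
    have e1 : (∫ t in (b - h)..b, y t) - (∫ t in (a - h)..a, y t) =
        ∫ t in Ioc a b, (y t - y (t - h)) := by
      rw [← intervalIntegral.integral_of_le hab, intervalIntegral.integral_sub
        (hy.intervalIntegrable _ _) (hyh.intervalIntegrable _ _),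
        intervalIntegral.integral_comp_sub_right]
      have := intervalIntegral.integral_interval_sub_interval_comm (μ := volume)
        (hy.intervalIntegrable a b) (hy.intervalIntegrable (a - h) (b - h))
        (hy.intervalIntegrable a (a - h))
      rw [this, intervalIntegral.integral_symm (a - h) a, intervalIntegral.integral_symm (b - h) b]
      ring
    have e2 : ∫ σ in (0 : ℝ)..h, c σ =
        ∫ t in Ioc a b, ∫ σ in (0 : ℝ)..h, B (Φ' (t - σ)) (W' t) := by
      simp only [intervalIntegral.integral_of_le hh.le]
      rw [← integral_integral_swap hres]
      refine integral_congr_ae (Filter.Eventually.of_forall fun σ => ?_)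
      refine (setIntegral_eq_integral_of_forall_compl_eq_zero fun t ht => ?_).symm
      simp [hW'def, ht]
    rw [e1, e2, ← integral_const_mul]
    refine integral_mono_ae ?_ ?_ (hpoint h hh)
    · exact ((hy.sub hyh).integrableOn_Icc (a := a) (b := b)).mono_set
        Ioc_subset_Icc_self
    · simp only [intervalIntegral.integral_of_le hh.le]
      exact (hres.integral_prod_right).const_mul 2
  -- the two sides of `hineq` vanish at `h = 0`; comparing their derivatives there gives the claim
  have hd1 : HasDerivAt (fun h : ℝ => ∫ t in (b - h)..b, y t) (y b) 0 := by
    have := (intervalIntegral.integral_hasDerivAt_left (a := b - 0) (b := b)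
      (hy.intervalIntegrable _ _) (hy.stronglyMeasurableAtFilter _ _)
      hy.continuousAt).comp (0 : ℝ) ((hasDerivAt_id (0 : ℝ)).const_sub b)
    simpa [Function.comp_def] using this
  have hd2 : HasDerivAt (fun h : ℝ => ∫ t in (a - h)..a, y t) (y a) 0 := by
    have := (intervalIntegral.integral_hasDerivAt_left (a := a - 0) (b := a)
      (hy.intervalIntegrable _ _) (hy.stronglyMeasurableAtFilter _ _)
      hy.continuousAt).comp (0 : ℝ) ((hasDerivAt_id (0 : ℝ)).const_sub a)
    simpa [Function.comp_def] using this
  have hd3 : HasDerivAt (fun h : ℝ => ∫ σ in (0 : ℝ)..h, c σ) (c 0) 0 :=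
    intervalIntegral.integral_hasDerivAt_right (hc.intervalIntegrable _ _)
      (hc.stronglyMeasurableAtFilter _ _) hc.continuousAt
  have hd := (hd3.const_mul 2).sub (hd1.sub hd2)
  have hlim := (hasDerivAt_iff_tendsto_slope.1 hd).mono_left
    (nhdsWithin_mono (0 : ℝ) (fun x (hx : x ∈ Ioi (0 : ℝ)) => (mem_Ioi.1 hx).ne'))
  have hge := ge_of_tendsto hlim (b := 0) (by
    filter_upwards [self_mem_nhdsWithin] with h (hh : 0 < h)
    have := hineq h hh
    simp only [slope_def_field, Pi.sub_apply, sub_zero, intervalIntegral.integral_same, mul_zero]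
    exact div_nonneg (by linarith) hh.le)
  have hya : y a = ‖w a‖ ^ 2 := by simp [hydef, hab]
  have hyb : y b = ‖w b‖ ^ 2 := by simp [hydef, hab]
  have hc0 : c 0 = ∫ r in a..b, B (Φ r) (W r) := by
    rw [intervalIntegral.integral_of_le hab, ← integral_indicator measurableSet_Ioc]
    simp only [hcdef, sub_zero]
    congr 1; ext t
    by_cases ht : t ∈ Ioc a b <;> simp [hΦ'def, hW'def, ht]
  rw [hya, hyb, hc0] at hge
  linarith

end Energy

/-! ### Measurability and integrability of the drift along a path -/

section Drift

variable {V H : Type*} [NormedAddCommGroup V] [NormedSpace ℝ V]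
  [NormedAddCommGroup H] [InnerProductSpace ℝ H] {ι : V →L[ℝ] H}

lemma toV_apply (hι : Function.Injective ι) (v : V) : toV ι (ι v) = v :=
  Function.leftInverse_invFun hι v

lemma apply_toV {h : H} (hh : h ∈ range ι) : ι (toV ι h) = h :=
  Function.invFun_eq (f := ι) hh

lemma toV_smul (hι : Function.Injective ι) (c : ℝ) {h : H} (hh : h ∈ range ι) :
    toV ι (c • h) = c • toV ι h := by
  obtain ⟨v, rfl⟩ := hh
  rw [← map_smul, toV_apply hι, toV_apply hι]

/-- The functionals `⟪h, ι ·⟫` are dense in `V*`, as a functional on `V*` that vanishes on them is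
the evaluation at a vector of `ker ι = 0`. Hence `V*` is separable when `H` is. -/
lemma secondCountableTopology_dual [TopologicalSpace.SeparableSpace H]
    (hr : Function.Surjective (NormedSpace.inclusionInDoubleDual ℝ V))
    (hι : Function.Injective ι) : SecondCountableTopology (StrongDual ℝ V) := by
  let J : H → StrongDual ℝ V := fun h => (innerSL ℝ h).comp ι
  have hJ : Continuous J := (innerSL ℝ).continuous.clm_comp_const ι
  let K : Submodule ℝ (StrongDual ℝ V) :=
    { carrier := range J
      add_mem' := by
        rintro _ _ ⟨h, rfl⟩ ⟨h', rfl⟩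
        exact ⟨h + h', by ext v; simp [J]⟩
      zero_mem' := ⟨0, by ext v; simp [J]⟩
      smul_mem' := by
        rintro c _ ⟨h, rfl⟩
        exact ⟨c • h, by ext v; simp [J]⟩ }
  have hdense : DenseRange J := by
    intro φ
    by_contra hφ
    change φ ∉ closure (K : Set (StrongDual ℝ V)) at hφ
    rw [← K.topologicalClosure_coe] at hφ
    obtain ⟨F, u, hF, huF⟩ := geometric_hahn_banach_closed_point
      K.topologicalClosure.convex K.isClosed_topologicalClosure hφ
    obtain ⟨v, rfl⟩ := hr F
    have hFJ : ∀ h : H, ⟪h, ι v⟫ = 0 := by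
      intro h
      by_contra hne
      have h1 := hF (J (((u + 1) / ⟪h, ι v⟫) • h))
        (K.le_topologicalClosure (mem_range_self _))
      have h2 : J (((u + 1) / ⟪h, ι v⟫) • h) v = u + 1 := by
        simp [J, div_mul_cancel₀ _ hne]
      rw [NormedSpace.dual_def, h2] at h1
      linarith
    have hv : v = 0 := hι (by rw [map_zero, ← inner_self_eq_zero (𝕜 := ℝ), hFJ])
    have h0 := hF 0 K.topologicalClosure.zero_mem
    rw [hv, map_zero] at h0 huF
    simp at h0 huF
    linarith
  have := hdense.separableSpace hJ
  exact UniformSpace.secondCountable_of_separable _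

lemma IsContinuousLp.smul {α τ T : ℝ} {u : ℝ → H} (hu : IsContinuousLp ι α τ T u)
    (hι : Function.Injective ι) {e : ℝ → ℝ} (he : ContinuousOn e (Icc τ (τ + T))) :
    IsContinuousLp ι α τ T fun t => e t • u t := by
  obtain ⟨M, hM⟩ := isCompact_Icc.exists_bound_of_continuousOn he
  refine ⟨he.smul hu.continuousOn, ?_, ?_⟩
  · filter_upwards [hu.ae_mem] with s ⟨v, hv⟩
    exact ⟨e s • v, by rw [map_smul, hv]⟩
  · have h1 : MemLp (fun s => e s • toV ι (u s)) (ENNReal.ofReal α)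
        (volume.restrict (Icc τ (τ + T))) := by
      refine hu.memLp.of_le_mul (c := M)
        ((he.aestronglyMeasurable measurableSet_Icc).smul hu.memLp.1) ?_
      filter_upwards [ae_restrict_mem measurableSet_Icc] with s hs
      rw [norm_smul]
      exact mul_le_mul_of_nonneg_right (hM s hs) (norm_nonneg _)
    refine (memLp_congr_ae ?_).2 h1
    filter_upwards [hu.ae_mem] with s hs
    exact toV_smul hι _ hs

variable [MeasurableSpace V] {A : ℝ → V → StrongDual ℝ V} {τ T α ϖ c C : ℝ} {f g : ℝ → ℝ}
  {η ρ : V → ℝ}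

/-- By the growth condition, the drift along a path that is bounded in `H` and `L^α` in `V` belongs
to the dual space `L^{α/(α-1)}` with values in `V*`. -/
lemma DriftAssumptions.memLp_drift [BorelSpace V] [SecondCountableTopology (StrongDual ℝ V)]
    (hA : DriftAssumptions ι A τ T α ϖ c C f g η ρ) {u : ℝ → H} (hu : IsContinuousLp ι α τ T u) :
    MemLp (fun r => A r (toV ι (u r))) (ENNReal.ofReal (α / (α - 1)))
      (volume.restrict (Icc τ (τ + T))) := by
  have hα := hA.two_le_alpha
  have hq : 0 < α / (α - 1) := div_pos (by linarith) (by linarith)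
  have hmeas : AEStronglyMeasurable (fun r => A r (toV ι (u r)))
      (volume.restrict (Icc τ (τ + T))) :=
    (hA.measurable_A.comp_aemeasurable
      (aemeasurable_id.prodMk hu.memLp.1.aemeasurable)).aestronglyMeasurable
  obtain ⟨M, hM⟩ := isCompact_Icc.exists_bound_of_continuousOn hu.continuousOn
  rw [← integrable_norm_rpow_iff hmeas (by simpa using hq) ENNReal.ofReal_ne_top,
    ENNReal.toReal_ofReal hq.le]
  have hint : Integrable (fun r => C * (|f r| + ‖toV ι (u r)‖ ^ α) * (1 + M ^ ϖ))
      (volume.restrict (Icc τ (τ + T))) := by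
    have h1 := hu.memLp.integrable_norm_rpow (by simpa using by linarith) ENNReal.ofReal_ne_top
    rw [ENNReal.toReal_ofReal (by linarith)] at h1
    exact ((hA.integrable_f.abs.add h1).const_mul C).mul_const _
  refine hint.mono' ((hmeas.norm.aemeasurable.pow_const _).aestronglyMeasurable) ?_
  filter_upwards [ae_restrict_mem measurableSet_Icc, hu.ae_mem] with r hr hmem
  rw [Real.norm_of_nonneg (Real.rpow_nonneg (norm_nonneg _) _)]
  refine (hA.growth r hr _).trans ?_
  rw [apply_toV hmem]
  have hC := hA.C_nonneg
  have hϖ := hA.varpi_nonneg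
  gcongr
  · exact le_abs_self _
  · exact hM r hr

end Drift

/-! ### Noise paths -/

section Noise

variable {γ₁ : ℝ≥0} {ω : ℝ → ℝ} {β : ℝ}

lemma IsNoisePath.exists_holderOnWith (hω : IsNoisePath γ₁ ω) (a b : ℝ) :
    ∃ K : ℝ≥0, HolderOnWith K γ₁ ω (Icc a b) := by
  obtain ⟨k, hk⟩ := exists_nat_ge (max (-a) b)
  obtain ⟨K, hK⟩ := hω.2 k
  exact ⟨K, hK.mono (Icc_subset_Icc (by linarith [le_max_left (-a) b])
    ((le_max_right _ _).trans hk))⟩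

lemma IsNoisePath.continuousOn (hω : IsNoisePath γ₁ ω) (hγ : 0 < γ₁) (a b : ℝ) :
    ContinuousOn ω (Icc a b) := by
  obtain ⟨K, hK⟩ := hω.exists_holderOnWith a b
  exact hK.continuousOn hγ

lemma IsNoisePath.continuousOn_exp (hω : IsNoisePath γ₁ ω) (hγ : 0 < γ₁) (β a b : ℝ) :
    ContinuousOn (fun t => Real.exp (β * ω t)) (Icc a b) :=
  ((hω.continuousOn hγ a b).const_mul β).rexp

end Noise

/-! ### The random equation: continuous dependence on the initial value -/

section Random

variable {V H : Type*} [NormedAddCommGroup V] [NormedSpace ℝ V]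
  [NormedAddCommGroup H] [InnerProductSpace ℝ H] {ι : V →L[ℝ] H}
  {A : ℝ → V → StrongDual ℝ V} {τ T α ϖ c C β : ℝ} {f g : ℝ → ℝ}
  {η ρ : V → ℝ} {ω : ℝ → ℝ} {γ₁ : ℝ≥0}

lemma IsRandomPDESolution.initial_eq {x : H} {u : ℝ → H} (hT : 0 ≤ T)
    (hι : DenseRange ι) (hu : IsRandomPDESolution ι A β ω α τ T x u) : u τ = x := by
  refine hι.eq_of_inner_left ℝ fun v => ?_
  have := hu.equation v τ ⟨le_rfl, by linarith⟩
  rwa [intervalIntegral.integral_same, add_zero] at this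

lemma IsRandomPDESolution.inner_sub {x : H} {u : ℝ → H}
    (hu : IsRandomPDESolution ι A β ω α τ T x u) (v : V) {s t : ℝ}
    (hs : s ∈ Icc τ (τ + T)) (ht : t ∈ Icc τ (τ + T)) :
    ⟪u t, ι v⟫ - ⟪u s, ι v⟫ = ∫ r in s..t,
      Real.exp (-β * ω r) * A r (Real.exp (β * ω r) • toV ι (u r)) v := by
  have hτ : τ ∈ Icc τ (τ + T) := ⟨le_rfl, hs.1.trans hs.2⟩
  rw [hu.equation v t ht, hu.equation v s hs, add_sub_add_left_eq_sub]
  exact intervalIntegral.integral_interval_sub_left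
    (intervalIntegrable_of_mem (hu.integrable v) hτ ht)
    (intervalIntegrable_of_mem (hu.integrable v) hτ hs)

variable [MeasurableSpace V]

/-- The drift of the random equation along a path lies in `L^{α/(α-1)}` with values in `V*`. -/
lemma DriftAssumptions.memLp_random_drift [BorelSpace V]
    [SecondCountableTopology (StrongDual ℝ V)]
    (hA : DriftAssumptions ι A τ T α ϖ c C f g η ρ) (hι : Function.Injective ι)
    (hω : IsNoisePath γ₁ ω) (hγ : 0 < γ₁) {u : ℝ → H} (hu : IsContinuousLp ι α τ T u) :
    MemLp (fun r => Real.exp (-β * ω r) • A r (Real.exp (β * ω r) • toV ι (u r)))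
      (ENNReal.ofReal (α / (α - 1))) (volume.restrict (Icc τ (τ + T))) := by
  have h1 := hA.memLp_drift (hu.smul hι (hω.continuousOn_exp hγ β τ (τ + T)))
  have h2 : MemLp (fun r => A r (Real.exp (β * ω r) • toV ι (u r)))
      (ENNReal.ofReal (α / (α - 1))) (volume.restrict (Icc τ (τ + T))) := by
    refine (memLp_congr_ae ?_).2 h1
    filter_upwards [hu.ae_mem] with r hr
    rw [toV_smul hι _ hr]
  have he := hω.continuousOn_exp hγ (-β) τ (τ + T)
  obtain ⟨M, hM⟩ := isCompact_Icc.exists_bound_of_continuousOn he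
  refine h2.of_le_mul (c := M) ((he.aestronglyMeasurable measurableSet_Icc).smul h2.1) ?_
  filter_upwards [ae_restrict_mem measurableSet_Icc] with s hs
  rw [norm_smul]
  exact mul_le_mul_of_nonneg_right (hM s hs) (norm_nonneg _)

/-- Local monotonicity is invariant under the scaling `v ↦ z⁻¹ v`. -/
lemma DriftAssumptions.scaled_monotonicity (hA : DriftAssumptions ι A τ T α ϖ c C f g η ρ)
    {t : ℝ} (ht : t ∈ Icc τ (τ + T)) (x : ℝ) (v₁ v₂ : V) :
    2 * (Real.exp (-x) • A t (Real.exp x • v₁) - Real.exp (-x) • A t (Real.exp x • v₂)) (v₁ - v₂) ≤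
      (f t + ρ (Real.exp x • v₁) + η (Real.exp x • v₂)) * ‖ι (v₁ - v₂)‖ ^ 2 := by
  have h := hA.local_monotonicity t ht (Real.exp x • v₂) (Real.exp x • v₁)
  have hx : Real.exp (-x) * Real.exp x = 1 := by rw [← Real.exp_add]; simp
  rw [← smul_sub, map_smul, map_smul, norm_smul, Real.norm_of_nonneg (Real.exp_pos x).le,
    ← neg_sub v₁ v₂, map_neg, map_neg, norm_neg] at h
  have h2 := mul_le_mul_of_nonneg_left h (sq_nonneg (Real.exp (-x)))
  simp only [sub_apply, smul_apply, smul_eq_mul, map_sub] at h2 ⊢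
  set p := Real.exp (-x)
  set q := Real.exp x
  set N := ‖ι v₁ - ι v₂‖
  have e1 : p ^ 2 * ((f t + η (q • v₂) + ρ (q • v₁)) * (q * N) ^ 2) =
      (p * q) ^ 2 * ((f t + ρ (q • v₁) + η (q • v₂)) * N ^ 2) := by ring
  rw [e1, hx, one_pow, one_mul] at h2
  refine le_trans (le_of_eq ?_) h2
  linear_combination (-2 * p * (A t (q • v₁) v₁ - A t (q • v₁) v₂ - A t (q • v₂) v₁
    + A t (q • v₂) v₂)) * hx

/-- The energy inequality, local monotonicity and Gronwall's inequality give the continuous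
dependence of solutions of the random equation on their initial values. -/
theorem IsRandomPDESolution.norm_sub_sq_le [BorelSpace V]
    [SecondCountableTopology (StrongDual ℝ V)]
    (hA : DriftAssumptions ι A τ T α ϖ c C f g η ρ) (hinj : Function.Injective ι)
    (hdense : DenseRange ι) (hω : IsNoisePath γ₁ ω) (hγ : 0 < γ₁) {x₁ x₂ : H} {u₁ u₂ : ℝ → H}
    (h₁ : IsRandomPDESolution ι A β ω α τ T x₁ u₁) (h₂ : IsRandomPDESolution ι A β ω α τ T x₂ u₂)
    (hint : IntegrableOn (fun s => ρ (Real.exp (β * ω s) • toV ι (u₁ s))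
          + η (Real.exp (β * ω s) • toV ι (u₂ s))) (Icc τ (τ + T)))
    {t : ℝ} (ht : t ∈ Icc τ (τ + T)) :
    ‖u₁ t - u₂ t‖ ^ 2 ≤ Real.exp (∫ s in τ..t, (f s
        + ρ (Real.exp (β * ω s) • toV ι (u₁ s)) + η (Real.exp (β * ω s) • toV ι (u₂ s))))
      * ‖x₁ - x₂‖ ^ 2 := by
  have hα := hA.two_le_alpha
  have hT : 0 ≤ T := by linarith [ht.1.trans ht.2]
  have hconj : (α / (α - 1)).HolderConjugate α :=
    ((Real.holderConjugate_iff_eq_conjExponent (by linarith)).mpr rfl).symm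
  have : (ENNReal.ofReal (α / (α - 1))).HolderConjugate (ENNReal.ofReal α) :=
    hconj.ennrealOfReal
  have : Fact (1 ≤ ENNReal.ofReal α) := ⟨ENNReal.one_le_ofReal.2 (by linarith)⟩
  have : Fact (1 ≤ ENNReal.ofReal (α / (α - 1))) := ⟨ENNReal.one_le_ofReal.2 hconj.lt.le⟩
  have : Fact (ENNReal.ofReal (α / (α - 1)) ≠ ⊤) := ⟨ENNReal.ofReal_ne_top⟩
  set Φ₁ : ℝ → StrongDual ℝ V := fun r =>
    Real.exp (-β * ω r) • A r (Real.exp (β * ω r) • toV ι (u₁ r)) with hΦ₁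
  set Φ₂ : ℝ → StrongDual ℝ V := fun r =>
    Real.exp (-β * ω r) • A r (Real.exp (β * ω r) • toV ι (u₂ r)) with hΦ₂
  set k : ℝ → ℝ := fun s => f s
        + ρ (Real.exp (β * ω s) • toV ι (u₁ s)) + η (Real.exp (β * ω s) • toV ι (u₂ s)) with hk
  have hΦ := (hA.memLp_random_drift (β := β) hinj hω hγ h₁.regular).sub
    (hA.memLp_random_drift (β := β) hinj hω hγ h₂.regular)
  have hW := h₁.regular.memLp.sub h₂.regular.memLp
  have hw := h₁.regular.continuousOn.sub h₂.regular.continuousOn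
  have hΦW : Integrable (fun r => (Φ₁ r - Φ₂ r) (toV ι (u₁ r) - toV ι (u₂ r)))
      (volume.restrict (Icc τ (τ + T))) :=
    memLp_one_iff_integrable.1
      ((ContinuousLinearMap.id ℝ (StrongDual ℝ V)).memLp_of_bilin 1 hΦ hW)
  have hki : IntervalIntegrable k volume τ (τ + T) := by
    rw [intervalIntegrable_iff_integrableOn_Icc_of_le (by linarith)]
    exact (hA.integrable_f.add hint).congr (Filter.Eventually.of_forall fun s => by
      simp only [hk, Pi.add_apply, add_assoc])
  have hΦWi : IntervalIntegrable (fun r => (Φ₁ r - Φ₂ r) (toV ι (u₁ r) - toV ι (u₂ r)))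
      volume τ (τ + T) := by
    rw [intervalIntegrable_iff_integrableOn_Icc_of_le (by linarith)]
    exact hΦW
  have hτ : τ ∈ Icc τ (τ + T) := ⟨le_rfl, by linarith⟩
  have hy : ContinuousOn (fun s => ‖u₁ s - u₂ s‖ ^ 2) (Icc τ (τ + T)) := hw.norm.pow 2
  have hG := gronwall_of_integrable (y := fun s => ‖u₁ s - u₂ s‖ ^ 2) ht.1
    (intervalIntegrable_of_mem hki hτ ht) (hy.mono (Icc_subset_Icc_right ht.2))
    fun s hs s' hs' hss' => by
      have hsI : s ∈ Icc τ (τ + T) := ⟨hs.1, hs.2.trans ht.2⟩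
      have hsI' : s' ∈ Icc τ (τ + T) := ⟨hs'.1, hs'.2.trans ht.2⟩
      have hsub : Icc s s' ⊆ Icc τ (τ + T) := Icc_subset_Icc hsI.1 hsI'.2
      have hres : volume.restrict (Ioc s s') ≤ volume.restrict (Icc τ (τ + T)) :=
        Measure.restrict_mono_set _ (Ioc_subset_Icc_self.trans hsub)
      have henergy := norm_sq_sub_norm_sq_le (ContinuousLinearMap.id ℝ (StrongDual ℝ V)) (ι := ι)
        (w := fun r => u₁ r - u₂ r) hss' (hΦ.mono_measure hres) (hW.mono_measure hres)
        (hw.mono hsub) (by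
          refine ae_mono hres ?_
          filter_upwards [h₁.regular.ae_mem, h₂.regular.ae_mem] with r hr1 hr2
          simp only [Pi.sub_apply, map_sub, apply_toV hr1, apply_toV hr2]) (by
          intro v r hr r' hr' _
          have i1 := intervalIntegrable_of_mem (h₁.integrable v) (hsub hr) (hsub hr')
          have i2 := intervalIntegrable_of_mem (h₂.integrable v) (hsub hr) (hsub hr')
          have e1 := h₁.inner_sub v (hsub hr) (hsub hr')
          have e2 := h₂.inner_sub v (hsub hr) (hsub hr')
          have e3 := intervalIntegral.integral_sub i1 i2
          rw [← e1, ← e2] at e3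
          rw [inner_sub_left, inner_sub_left]
          refine Eq.trans (by ring) e3.symm)
      refine henergy.trans ?_
      rw [← intervalIntegral.integral_const_mul]
      have i1 := intervalIntegrable_of_mem hki hsI hsI'
      refine intervalIntegral.integral_mono_ae_restrict hss'
        ((intervalIntegrable_of_mem hΦWi hsI hsI').const_mul 2)
        (i1.mul_continuousOn (hy.mono (uIcc_subset_Icc hsI hsI'))) ?_
      refine ae_mono (Measure.restrict_mono_set _ hsub) ?_
      filter_upwards [h₁.regular.ae_mem, h₂.regular.ae_mem, ae_restrict_mem measurableSet_Icc]
        with r hr1 hr2 hr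
      have := hA.scaled_monotonicity hr (β * ω r) (toV ι (u₁ r)) (toV ι (u₂ r))
      rw [map_sub ι, apply_toV hr1, apply_toV hr2, ← neg_mul] at this
      exact this
  rwa [h₁.initial_eq hT hdense, h₂.initial_eq hT hdense] at hG

end Random

/-! ### Hölder continuity -/

lemma holderOnWith_of_abs_le {K : ℝ} {γ : ℝ≥0} {φ : ℝ → ℝ} {S : Set ℝ}
    (h : ∀ s ∈ S, ∀ t ∈ S, |φ s - φ t| ≤ K * |s - t| ^ (γ : ℝ)) :
    HolderOnWith K.toNNReal γ φ S := by
  intro s hs t ht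
  rw [edist_dist, edist_dist, Real.dist_eq, Real.dist_eq,
    ENNReal.ofReal_rpow_of_nonneg (abs_nonneg _) γ.coe_nonneg]
  change _ ≤ ENNReal.ofReal K * _
  rw [← ENNReal.ofReal_mul' (by positivity)]
  exact ENNReal.ofReal_le_ofReal (h s hs t ht)

lemma HolderOnWith.abs_sub_le {K γ : ℝ≥0} {φ : ℝ → ℝ} {S : Set ℝ} (h : HolderOnWith K γ φ S) :
    ∀ s ∈ S, ∀ t ∈ S, |φ s - φ t| ≤ K * |s - t| ^ (γ : ℝ) := fun s hs t ht => by
  simpa [Real.dist_eq] using h.dist_le hs ht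

lemma exists_holderOnWith_of_le {K γ γ' : ℝ≥0} {φ : ℝ → ℝ} {a b : ℝ}
    (h : HolderOnWith K γ φ (Icc a b)) (hγ : γ' ≤ γ) :
    ∃ K' : ℝ≥0, HolderOnWith K' γ' φ (Icc a b) := by
  refine ⟨_, h.of_le (D := (b - a).toNNReal) (fun s hs t ht => ?_) hγ⟩
  rw [edist_dist, Real.dist_eq]
  refine ENNReal.ofReal_le_ofReal (abs_sub_le_iff.2 ⟨?_, ?_⟩) <;>
    linarith [hs.1, hs.2, ht.1, ht.2]

lemma exists_holderOnWith_mul {K K' γ : ℝ≥0} {e φ : ℝ → ℝ} {a b : ℝ} (hγ : 0 < γ)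
    (he : HolderOnWith K γ e (Icc a b)) (hφ : HolderOnWith K' γ φ (Icc a b)) :
    ∃ L : ℝ≥0, HolderOnWith L γ (fun t => e t * φ t) (Icc a b) := by
  obtain ⟨M, hM⟩ := isCompact_Icc.exists_bound_of_continuousOn (he.continuousOn hγ)
  obtain ⟨N, hN⟩ := isCompact_Icc.exists_bound_of_continuousOn (hφ.continuousOn hγ)
  refine ⟨_, holderOnWith_of_abs_le (K := M * K' + N * K) fun s hs t ht => ?_⟩
  have h1 := HolderOnWith.abs_sub_le he s hs t ht
  have h2 := HolderOnWith.abs_sub_le hφ s hs t ht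
  have h3 : |e s| ≤ M := hM s hs
  have h4 : |φ t| ≤ N := hN t ht
  calc |e s * φ s - e t * φ t| = |e s * (φ s - φ t) + φ t * (e s - e t)| := by congr 1; ring
    _ ≤ |e s| * |φ s - φ t| + |φ t| * |e s - e t| := by
      rw [← abs_mul, ← abs_mul]; exact abs_add_le _ _
    _ ≤ M * (K' * |s - t| ^ (γ : ℝ)) + N * (K * |s - t| ^ (γ : ℝ)) :=
      add_le_add (mul_le_mul h3 h2 (abs_nonneg _) ((abs_nonneg _).trans h3))
        (mul_le_mul h4 h1 (abs_nonneg _) ((abs_nonneg _).trans h4))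
    _ = _ := by ring

lemma exists_holderOnWith_exp {K γ : ℝ≥0} {ω : ℝ → ℝ} {a b : ℝ} (hγ : 0 < γ)
    (hω : HolderOnWith K γ ω (Icc a b)) (β : ℝ) :
    ∃ L : ℝ≥0, HolderOnWith L γ (fun t => Real.exp (β * ω t)) (Icc a b) := by
  obtain ⟨M, hM⟩ := isCompact_Icc.exists_bound_of_continuousOn
    ((hω.continuousOn hγ).const_mul β).rexp
  refine ⟨_, holderOnWith_of_abs_le (K := M * (|β| * K)) fun s hs t ht => ?_⟩
  have hexp : ∀ x y : ℝ, Real.exp x ≤ M → Real.exp x - Real.exp y ≤ M * |x - y| := by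
    intro x y hx
    have h1 := Real.add_one_le_exp (y - x)
    have h2 : Real.exp y = Real.exp x * Real.exp (y - x) := by rw [← Real.exp_add]; congr 1; ring
    calc Real.exp x - Real.exp y = Real.exp x * (1 - Real.exp (y - x)) := by rw [h2]; ring
      _ ≤ Real.exp x * |x - y| := by
        gcongr
        linarith [le_abs_self (x - y)]
      _ ≤ M * |x - y| := by gcongr
  have hb : ∀ r ∈ Icc a b, Real.exp (β * ω r) ≤ M := fun r hr => by
    simpa using hM r hr
  have h1 : |Real.exp (β * ω s) - Real.exp (β * ω t)| ≤ M * |β * ω s - β * ω t| := by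
    rw [abs_sub_le_iff]
    exact ⟨hexp _ _ (hb s hs), by rw [abs_sub_comm]; exact hexp _ _ (hb t ht)⟩
  have hM0 : 0 ≤ M := (Real.exp_pos _).le.trans (hb s hs)
  refine h1.trans ?_
  rw [← mul_sub, abs_mul, mul_assoc, mul_assoc]
  gcongr
  exact HolderOnWith.abs_sub_le hω s hs t ht

/-- By Hölder's inequality, a primitive of an `L^q` function is Hölder continuous with exponent
`1 - 1 / q`. -/
lemma exists_holderOnWith_of_memLp {q a b : ℝ} (hq : 1 ≤ q) {φ ψ : ℝ → ℝ}
    (hψ : MemLp ψ (ENNReal.ofReal q) (volume.restrict (Icc a b)))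
    (hφ : ∀ s ∈ Icc a b, ∀ t ∈ Icc a b, φ t - φ s = ∫ r in s..t, ψ r) :
    ∃ K : ℝ≥0, HolderOnWith K (1 - 1 / q).toNNReal φ (Icc a b) := by
  have hq' : 0 ≤ 1 - 1 / q := sub_nonneg.2 ((div_le_one (by linarith)).2 hq)
  have key : ∀ s ∈ Icc a b, ∀ t ∈ Icc a b, s ≤ t → edist (φ t) (φ s) ≤
      eLpNorm ψ (ENNReal.ofReal q) (volume.restrict (Icc a b)) * edist t s ^ (1 - 1 / q) := by
    intro s hs t ht hst
    have hres : volume.restrict (Ioc s t) ≤ volume.restrict (Icc a b) :=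
      Measure.restrict_mono_set _ (Ioc_subset_Icc_self.trans (Icc_subset_Icc hs.1 ht.2))
    rw [edist_eq_enorm_sub, hφ s hs t ht, intervalIntegral.integral_of_le hst]
    refine (enorm_integral_le_lintegral_enorm _).trans ?_
    rw [← eLpNorm_one_eq_lintegral_enorm]
    have h1 := eLpNorm_le_eLpNorm_mul_rpow_measure_univ (p := 1) (q := ENNReal.ofReal q)
      (ENNReal.one_le_ofReal.2 hq) (hψ.1.mono_measure hres)
    rw [ENNReal.toReal_one, ENNReal.toReal_ofReal (by linarith), Measure.restrict_apply_univ,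
      Real.volume_Ioc, div_one] at h1
    rw [edist_dist, Real.dist_eq, abs_of_nonneg (sub_nonneg.2 hst)]
    exact h1.trans (mul_le_mul_left (eLpNorm_mono_measure ψ hres) _)
  refine ⟨(eLpNorm ψ (ENNReal.ofReal q) (volume.restrict (Icc a b))).toNNReal,
    fun s hs t ht => ?_⟩
  rw [ENNReal.coe_toNNReal hψ.2.ne, Real.coe_toNNReal _ hq']
  rcases le_total s t with hst | hst
  · rw [edist_comm, edist_comm s t]; exact key s hs t ht hst
  · exact key t ht s hs hst

/-! ### The exponential change of variables for scalar equations -/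

section Scalar

variable {γ₁ : ℝ≥0} {ω : ℝ → ℝ} {a b : ℝ}

/-- Since `2 γ₁ > 1`, the exponential of the noise obeys the first-order chain rule up to a
negligible remainder. -/
lemma IsNoisePath.isNegligible_exp (hω : IsNoisePath γ₁ ω) (hγ₁ : (1 / 2 : ℝ) < γ₁) (β : ℝ) :
    IsNegligible id a b fun s t =>
      Real.exp (β * ω t - β * ω s) - 1 - (β * ω t - β * ω s) := by
  have hγ : 0 < γ₁ := by rw [← NNReal.coe_pos]; linarith
  obtain ⟨K, hK⟩ := hω.exists_holderOnWith a b
  refine IsNegligible.exp_taylor ((hω.continuousOn hγ a b).const_mul β) ?_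
  refine IsNegligible.of_le_rpow (K := (β * K) ^ 2) (θ := γ₁ + γ₁) (by linarith)
    ⟨1, one_pos, fun s hs t ht hst _ => ?_⟩
  have h1 := HolderOnWith.abs_sub_le hK t ht s hs
  rw [abs_of_nonneg (sub_nonneg.2 hst)] at h1
  have h2 : (t - s) ^ ((γ₁ : ℝ) + γ₁) = ((t - s) ^ (γ₁ : ℝ)) ^ 2 := by
    rw [pow_two, Real.rpow_add_of_nonneg (sub_nonneg.2 hst) γ₁.coe_nonneg γ₁.coe_nonneg]
  rw [abs_of_nonneg (sq_nonneg _), h2]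
  calc (β * ω t - β * ω s) ^ 2 = β ^ 2 * |ω t - ω s| ^ 2 := by rw [sq_abs]; ring
    _ ≤ β ^ 2 * (K * (t - s) ^ (γ₁ : ℝ)) ^ 2 := by gcongr
    _ = _ := by ring

/-- If `φ` has derivative `ψ`, then `X = exp (β ω) φ` satisfies `dX = exp (β ω) ψ dt + β X dω`. -/
lemma IsNoisePath.hasYoungIntegral_exp_mul (hω : IsNoisePath γ₁ ω) (hγ₁ : (1 / 2 : ℝ) < γ₁)
    (β : ℝ) {φ ψ : ℝ → ℝ} (hψ : IntervalIntegrable ψ volume a b)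
    (hφ : ∀ s ∈ Icc a b, ∀ t ∈ Icc a b, φ t - φ s = ∫ r in s..t, ψ r)
    {t : ℝ} (ht : t ∈ Icc a b) :
    HasYoungIntegral (fun r => β * (Real.exp (β * ω r) * φ r)) ω a t
      (Real.exp (β * ω t) * φ t - Real.exp (β * ω a) * φ a
        - ∫ r in a..t, Real.exp (β * ω r) * ψ r) := by
  have hγ : 0 < γ₁ := by rw [← NNReal.coe_pos]; linarith
  have hab : a ≤ b := ht.1.trans ht.2
  have ha : a ∈ Icc a b := ⟨le_rfl, hab⟩
  have he := hω.continuousOn_exp hγ β a b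
  have hφc : ContinuousOn φ (Icc a b) := by
    refine ((continuousOn_primitive hab hψ).const_add (φ a)).congr fun s hs => ?_
    have := hφ a ha s hs
    linarith
  obtain ⟨M, hM⟩ := isCompact_Icc.exists_bound_of_continuousOn (he.mul hφc)
  have heψ : IntervalIntegrable (fun r => Real.exp (β * ω r) * ψ r) volume a b :=
    hψ.continuousOn_mul (by rwa [uIcc_of_le hab])
  have r1 : IsNegligible (control a ψ) a b fun s t =>
      ∫ r in s..t, (Real.exp (β * ω t) - Real.exp (β * ω r)) * ψ r :=
    IsNegligible.of_integral he hψ fun s t r hr => ⟨t, ⟨hr.1.trans hr.2, le_rfl⟩, by rw [abs_mul]⟩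
  have r2 := ((hω.isNegligible_exp hγ₁ β).control_of_id hψ).bounded_mul
    (c := fun s _ => Real.exp (β * ω s) * φ s) (M := M) fun s hs _ _ => hM s hs
  set J : ℝ → ℝ := fun t => Real.exp (β * ω t) * φ t - ∫ r in a..t, Real.exp (β * ω r) * ψ r
  have r3 : IsNegligible (control a ψ) a b fun s t =>
      β * (Real.exp (β * ω s) * φ s) * (ω t - ω s) - (J t - J s) := by
    refine (r1.add r2).neg.congr fun s hs t ht _ => ?_
    have i1 := intervalIntegrable_of_mem hψ hs ht
    have i2 := intervalIntegrable_of_mem heψ hs ht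
    have e1 : ∫ r in s..t, (Real.exp (β * ω t) - Real.exp (β * ω r)) * ψ r =
        Real.exp (β * ω t) * (φ t - φ s) - ∫ r in s..t, Real.exp (β * ω r) * ψ r := by
      rw [hφ s hs t ht, ← intervalIntegral.integral_const_mul,
        ← intervalIntegral.integral_sub (i1.const_mul _) i2]
      congr 1; ext r; ring
    have e2 : J t - J s = Real.exp (β * ω t) * φ t - Real.exp (β * ω s) * φ s
        - ∫ r in s..t, Real.exp (β * ω r) * ψ r := by
      rw [← intervalIntegral.integral_interval_sub_left (intervalIntegrable_of_mem heψ ha ht)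
        (intervalIntegrable_of_mem heψ ha hs)]
      simp only [J]
      ring
    have e3 : Real.exp (β * ω t) = Real.exp (β * ω s) * Real.exp (β * ω t - β * ω s) := by
      rw [← Real.exp_add]; congr 1; ring
    rw [e1, e2]
    linear_combination -(φ s) * e3
  have h := hasYoungIntegral_of_isNegligible (r3.mono_interval ht.2) (control_le hψ ha ht ht.1)
  convert h using 1
  simp only [J, intervalIntegral.integral_same]
  ring

/-- If `dX = ψ dt + β X dω` with a Young integral, then `exp (-β ω) X` has derivative
`exp (-β ω) ψ`. The Young–Loève estimate localises the integral. -/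
lemma IsNoisePath.exp_mul_eq_of_hasYoungIntegral (hω : IsNoisePath γ₁ ω)
    (hγ₁ : (1 / 2 : ℝ) < γ₁) (β : ℝ) {γ₂ : ℝ≥0} (hγ₂ : 0 < γ₂) (hγ : 1 < γ₁ + γ₂)
    {K : ℝ≥0} {X ψ I : ℝ → ℝ}
    {x₀ : ℝ} (hX : HolderOnWith K γ₂ X (Icc a b)) (hψ : IntervalIntegrable ψ volume a b)
    (hI : ∀ t ∈ Icc a b, HasYoungIntegral (fun r => β * X r) ω a t (I t))
    (heq : ∀ t ∈ Icc a b, X t = x₀ + (∫ r in a..t, ψ r) + I t) {t : ℝ} (ht : t ∈ Icc a b) :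
    Real.exp (-β * ω t) * X t =
      Real.exp (-β * ω a) * x₀ + ∫ r in a..t, Real.exp (-β * ω r) * ψ r := by
  have hγ₁' : 0 < γ₁ := by rw [← NNReal.coe_pos]; linarith
  have hγ' : (1 : ℝ) < γ₁ + γ₂ := by exact_mod_cast hγ
  have hab : a ≤ b := ht.1.trans ht.2
  have ha : a ∈ Icc a b := ⟨le_rfl, hab⟩
  have hz := hω.continuousOn_exp hγ₁' (-β) a b
  obtain ⟨M, hM⟩ := isCompact_Icc.exists_bound_of_continuousOn hz
  obtain ⟨N, hN⟩ := isCompact_Icc.exists_bound_of_continuousOn (hX.continuousOn hγ₂)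
  obtain ⟨L, hL⟩ := hω.exists_holderOnWith a b
  have hzψ : IntervalIntegrable (fun r => Real.exp (-β * ω r) * ψ r) volume a b :=
    hψ.continuousOn_mul (by rwa [uIcc_of_le hab])
  have hβX : ∀ s ∈ Icc a b, ∀ t ∈ Icc a b,
      |β * X s - β * X t| ≤ |β| * K * |s - t| ^ (γ₂ : ℝ) := fun s hs t ht => by
    rw [← mul_sub, abs_mul, mul_assoc]
    exact mul_le_mul_of_nonneg_left (HolderOnWith.abs_sub_le hX s hs t ht) (abs_nonneg _)
  have r1 : IsNegligible (control a ψ) a b fun s t =>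
      ∫ r in s..t, (Real.exp (-β * ω t) - Real.exp (-β * ω r)) * ψ r :=
    IsNegligible.of_integral hz hψ fun s t r hr => ⟨t, ⟨hr.1.trans hr.2, le_rfl⟩, by rw [abs_mul]⟩
  have r2 : IsNegligible id a b fun s t => I t - I s - β * X s * (ω t - ω s) :=
    IsNegligible.of_le_rpow hγ' ⟨1, one_pos, fun s hs t ht hst _ =>
      HasYoungIntegral.abs_sub_sub_le L.coe_nonneg (by positivity) hγ'
        (HolderOnWith.abs_sub_le hL) hβX hs ht hst (hI s hs) (hI t ht)⟩
  have r2' := (r2.control_of_id hψ).bounded_mul (c := fun _ t => Real.exp (-β * ω t)) (M := M)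
    fun _ _ t ht => hM t ht
  have r3 := ((hω.isNegligible_exp hγ₁ β).control_of_id hψ).bounded_mul
    (c := fun s t => -(X s * Real.exp (-β * ω t))) (M := N * M) fun s hs t ht => by
      rw [abs_neg, abs_mul]
      exact mul_le_mul (hN s hs) (hM t ht) (abs_nonneg _) ((norm_nonneg _).trans (hN s hs))
  set D : ℝ → ℝ := fun t => Real.exp (-β * ω t) * X t - ∫ r in a..t, Real.exp (-β * ω r) * ψ r
    with hD
  have r4 : IsNegligible (control a ψ) a b fun s t => D t - D s := by
    refine ((r1.add r2').add r3).congr fun s hs t ht _ => ?_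
    have i1 := intervalIntegrable_of_mem hψ hs ht
    have i2 := intervalIntegrable_of_mem hzψ hs ht
    have e0 : X t - X s = (∫ r in s..t, ψ r) + (I t - I s) := by
      rw [heq t ht, heq s hs, ← intervalIntegral.integral_interval_sub_left
        (intervalIntegrable_of_mem hψ ha ht) (intervalIntegrable_of_mem hψ ha hs)]
      ring
    have e1 : ∫ r in s..t, (Real.exp (-β * ω t) - Real.exp (-β * ω r)) * ψ r =
        Real.exp (-β * ω t) * (∫ r in s..t, ψ r) - ∫ r in s..t, Real.exp (-β * ω r) * ψ r := by
      rw [← intervalIntegral.integral_const_mul,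
        ← intervalIntegral.integral_sub (i1.const_mul _) i2]
      congr 1; ext r; ring
    have e2 : D t - D s = Real.exp (-β * ω t) * X t - Real.exp (-β * ω s) * X s
        - ∫ r in s..t, Real.exp (-β * ω r) * ψ r := by
      rw [← intervalIntegral.integral_interval_sub_left (intervalIntegrable_of_mem hzψ ha ht)
        (intervalIntegrable_of_mem hzψ ha hs)]
      simp only [D]
      ring
    have e3 : Real.exp (-β * ω s) = Real.exp (-β * ω t) * Real.exp (β * ω t - β * ω s) := by
      rw [← Real.exp_add]; congr 1; ring
    rw [e1, e2]
    linear_combination Real.exp (-β * ω t) * e0 - X s * e3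
  have hconst := (r4.mono_interval ht.2).eq_of_sub_eq ht.1 (control_le hψ ha ht ht.1)
  have hIa : I a = 0 := (hI a ha).eq_zero
  have hXa : X a = x₀ := by rw [heq a ha, hIa, intervalIntegral.integral_same]; ring
  simp only [hD, intervalIntegral.integral_same, hXa] at hconst
  linarith

end Scalar

/-! ### Equivalence of the random and the stochastic equation -/

section Transformation

variable {V H : Type*} [NormedAddCommGroup V] [NormedSpace ℝ V]
  [NormedAddCommGroup H] [InnerProductSpace ℝ H] {ι : V →L[ℝ] H}
  {A : ℝ → V → StrongDual ℝ V} {τ T α ϖ c C β : ℝ} {f g : ℝ → ℝ}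
  {η ρ : V → ℝ} {ω : ℝ → ℝ} {γ₁ : ℝ≥0}

lemma ae_restrict_uIoc {P : ℝ → Prop} {a b s t : ℝ} (h : ∀ᵐ r ∂volume.restrict (Icc a b), P r)
    (hs : s ∈ Icc a b) (ht : t ∈ Icc a b) : ∀ᵐ r ∂volume.restrict (uIoc s t), P r :=
  ae_mono (Measure.restrict_mono_set _ (uIoc_subset_uIcc.trans (uIcc_subset_Icc hs ht))) h

lemma exp_mul_exp_neg (β x : ℝ) : Real.exp (β * x) * Real.exp (-β * x) = 1 := by
  rw [← Real.exp_add]; simp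

/-- If `ũ` solves the random equation, then `z⁻¹ ũ` solves the stochastic one. -/
theorem IsRandomPDESolution.isSPDESolution [MeasurableSpace V] [BorelSpace V]
    [SecondCountableTopology (StrongDual ℝ V)]
    (hA : DriftAssumptions ι A τ T α ϖ c C f g η ρ) (hinj : Function.Injective ι) (hT : 0 ≤ T)
    (hω : IsNoisePath γ₁ ω) (hγ₁ : (1 / 2 : ℝ) < γ₁) {γ₂ : ℝ≥0} (hγ₂ : 0 < γ₂)
    (hγα : (γ₂ : ℝ) ≤ 1 / α) (hγγ : γ₂ ≤ γ₁) {x : H} {u : ℝ → H}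
    (hu : IsRandomPDESolution ι A β ω α τ T (Real.exp (-β * ω τ) • x) u) :
    IsSPDESolution ι A β ω γ₂ α τ T x fun t => Real.exp (β * ω t) • u t := by
  have hα := hA.two_le_alpha
  have hγ : 0 < γ₁ := by rw [← NNReal.coe_pos]; linarith
  have hτ : τ ∈ Icc τ (τ + T) := ⟨le_rfl, by linarith⟩
  have hτT : τ + T ∈ Icc τ (τ + T) := ⟨by linarith, le_rfl⟩
  have he := hω.continuousOn_exp hγ β τ (τ + T)
  -- the drift of the random equation, multiplied by `z⁻¹`, is that of the stochastic equation
  have hdrift : ∀ v, ∀ᵐ r ∂volume.restrict (Icc τ (τ + T)),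
      Real.exp (β * ω r) *
        (Real.exp (-β * ω r) * A r (Real.exp (β * ω r) • toV ι (u r)) v) =
        A r (toV ι (Real.exp (β * ω r) • u r)) v := fun v => by
    filter_upwards [hu.regular.ae_mem] with r hr
    rw [toV_smul hinj _ hr, ← mul_assoc, exp_mul_exp_neg, one_mul]
  refine ⟨hu.regular.smul hinj he, fun v => ?_, fun v => ?_, fun v t ht => ?_⟩
  · simp only [inner_smul_left, RCLike.conj_to_real]
    have hΦ := hA.memLp_random_drift (β := β) hinj hω hγ hu.regular
    have hψ : MemLp (fun r => Real.exp (-β * ω r) * A r (Real.exp (β * ω r) • toV ι (u r)) v)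
        (ENNReal.ofReal (α / (α - 1))) (volume.restrict (Icc τ (τ + T))) :=
      (ContinuousLinearMap.apply ℝ ℝ v).comp_memLp' hΦ
    obtain ⟨K₁, hK₁⟩ := exists_holderOnWith_of_memLp
      ((one_le_div (by linarith)).2 (by linarith)) hψ fun s hs t ht => hu.inner_sub v hs ht
    obtain ⟨K₂, hK₂⟩ := exists_holderOnWith_of_le (γ' := γ₂) hK₁ (by
      rw [← NNReal.coe_le_coe]
      refine (hγα.trans (le_of_eq ?_)).trans (Real.le_coe_toNNReal _)
      have : α - 1 ≠ 0 := by linarith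
      field_simp
      ring)
    obtain ⟨K, hK⟩ := hω.exists_holderOnWith τ (τ + T)
    obtain ⟨L₁, hL₁⟩ := exists_holderOnWith_exp hγ hK β
    obtain ⟨L₂, hL₂⟩ := exists_holderOnWith_of_le hL₁ hγγ
    exact exists_holderOnWith_mul hγ₂ hL₂ hK₂
  · exact ((hu.integrable v).continuousOn_mul (by rwa [uIcc_of_le hτT.1])).congr_ae
      (ae_restrict_uIoc (hdrift v) hτ hτT)
  · refine ⟨Real.exp (β * ω t) * ⟪u t, ι v⟫ - Real.exp (β * ω τ) * ⟪u τ, ι v⟫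
      - ∫ r in τ..t, Real.exp (β * ω r) *
        (Real.exp (-β * ω r) * A r (Real.exp (β * ω r) • toV ι (u r)) v), ?_, ?_⟩
    · simp only [inner_smul_left, RCLike.conj_to_real]
      exact hω.hasYoungIntegral_exp_mul hγ₁ β (hu.integrable v)
        (fun s hs t ht => hu.inner_sub v hs ht) ht
    · rw [intervalIntegral.integral_congr_ae_restrict (ae_restrict_uIoc (hdrift v) hτ ht)]
      have h0 := hu.equation v τ hτ
      rw [intervalIntegral.integral_same, add_zero, inner_smul_left, RCLike.conj_to_real] at h0
      rw [h0, ← mul_assoc, exp_mul_exp_neg, inner_smul_left, RCLike.conj_to_real]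
      ring

/-- If `u` solves the stochastic equation, then `z u` solves the random one. -/
theorem IsSPDESolution.isRandomPDESolution (hinj : Function.Injective ι) (hT : 0 ≤ T)
    (hω : IsNoisePath γ₁ ω) (hγ₁ : (1 / 2 : ℝ) < γ₁) {γ₂ : ℝ≥0} (hγ₂ : 0 < γ₂)
    (hγ : 1 < γ₁ + γ₂) {x : H} {u : ℝ → H} (hu : IsSPDESolution ι A β ω γ₂ α τ T x u) :
    IsRandomPDESolution ι A β ω α τ T (Real.exp (-β * ω τ) • x)
      fun t => Real.exp (-β * ω t) • u t := by
  have hγ₁' : 0 < γ₁ := by rw [← NNReal.coe_pos]; linarith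
  have hτ : τ ∈ Icc τ (τ + T) := ⟨le_rfl, by linarith⟩
  have hτT : τ + T ∈ Icc τ (τ + T) := ⟨by linarith, le_rfl⟩
  have hz := hω.continuousOn_exp hγ₁' (-β) τ (τ + T)
  have hdrift : ∀ v, ∀ᵐ r ∂volume.restrict (Icc τ (τ + T)),
      Real.exp (-β * ω r) * A r (toV ι (u r)) v = Real.exp (-β * ω r) *
        A r (Real.exp (β * ω r) • toV ι (Real.exp (-β * ω r) • u r)) v := fun v => by
    filter_upwards [hu.regular.ae_mem] with r hr
    rw [toV_smul hinj _ hr, smul_smul, exp_mul_exp_neg, one_smul]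
  refine ⟨hu.regular.smul hinj hz, fun v => ?_, fun v t ht => ?_⟩
  · exact ((hu.integrable v).continuousOn_mul (by rwa [uIcc_of_le hτT.1])).congr_ae
      (ae_restrict_uIoc (hdrift v) hτ hτT)
  · obtain ⟨K, hK⟩ := hu.holder v
    choose! I hI heq using hu.equation v
    rw [← intervalIntegral.integral_congr_ae_restrict (ae_restrict_uIoc (hdrift v) hτ ht)]
    simp only [inner_smul_left, RCLike.conj_to_real]
    exact hω.exp_mul_eq_of_hasYoungIntegral hγ₁ β hγ₂ hγ hK (hu.integrable v) hI heq ht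

/-- Undoing the scaling by `z` costs the factor `(z_τ / z_t)²`. -/
lemma norm_sub_sq_le_of_scaled {M E : ℝ} {t : ℝ} (hE : 0 ≤ E)
    (hM : Real.exp (2 * β * (ω t - ω τ)) ≤ M) {x₁ x₂ y₁ y₂ : H}
    (h : ‖y₁ - y₂‖ ^ 2 ≤ E * ‖Real.exp (-β * ω τ) • x₁ - Real.exp (-β * ω τ) • x₂‖ ^ 2) :
    ‖Real.exp (β * ω t) • y₁ - Real.exp (β * ω t) • y₂‖ ^ 2 ≤ M * E * ‖x₁ - x₂‖ ^ 2 := by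
  rw [← smul_sub, norm_smul, Real.norm_of_nonneg (Real.exp_pos _).le, mul_pow] at h ⊢
  have e1 : Real.exp (2 * β * (ω t - ω τ)) =
      Real.exp (β * ω t) ^ 2 * Real.exp (-β * ω τ) ^ 2 := by
    rw [← Real.exp_nat_mul, ← Real.exp_nat_mul, ← Real.exp_add]
    congr 1; push_cast; ring
  rw [e1] at hM
  calc Real.exp (β * ω t) ^ 2 * ‖y₁ - y₂‖ ^ 2
      ≤ Real.exp (β * ω t) ^ 2 * (E * (Real.exp (-β * ω τ) ^ 2 * ‖x₁ - x₂‖ ^ 2)) := by gcongr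
    _ = (Real.exp (β * ω t) ^ 2 * Real.exp (-β * ω τ) ^ 2) * E * ‖x₁ - x₂‖ ^ 2 := by ring
    _ ≤ M * E * ‖x₁ - x₂‖ ^ 2 := by gcongr

end Transformation

end FractionalSPDE

/-! ### Continuous dependence for the stochastic equation -/

theorem mainTheorem9 (τ T β : ℝ) (hT : 0 < T)
    (γ₁ : ℝ≥0) (hγ₁ : (1 / 2 : ℝ) < γ₁) (hγ₁' : (γ₁ : ℝ) < 1)
    (ω : ℝ → ℝ) (hω : FractionalSPDE.IsNoisePath γ₁ ω) :
    -- the constant depends on `T, τ, ω, β` only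
    ∃ C₀ : ℝ, 0 < C₀ ∧
    ∀ (V : Type*) [NormedAddCommGroup V] [NormedSpace ℝ V] [CompleteSpace V]
      [MeasurableSpace V] [BorelSpace V]
      (H : Type*) [NormedAddCommGroup H] [InnerProductSpace ℝ H] [CompleteSpace H]
      [TopologicalSpace.SeparableSpace H]
      (ι : V →L[ℝ] H) (_ : FractionalSPDE.IsCompactGelfandEmbedding ι)
      (A : ℝ → V → StrongDual ℝ V) (α ϖ c C : ℝ) (f g : ℝ → ℝ) (η ρ : V → ℝ)
      (_ : FractionalSPDE.DriftAssumptions ι A τ T α ϖ c C f g η ρ),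
      -- solutions `ut₁, ut₂` of the random PDE, and `uᵢ = z⁻¹ utᵢ`
      (∀ (u₁τ u₂τ : H) (ut₁ ut₂ : ℝ → H),
        FractionalSPDE.IsRandomPDESolution ι A β ω α τ T (Real.exp (-β * ω τ) • u₁τ) ut₁ →
        FractionalSPDE.IsRandomPDESolution ι A β ω α τ T (Real.exp (-β * ω τ) • u₂τ) ut₂ →
        IntegrableOn (fun s => ρ (Real.exp (β * ω s) • FractionalSPDE.toV ι (ut₁ s))
          + η (Real.exp (β * ω s) • FractionalSPDE.toV ι (ut₂ s))) (Icc τ (τ + T)) →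
        (∀ t ∈ Icc τ (τ + T),
          ‖ut₁ t - ut₂ t‖ ^ 2 ≤
            Real.exp (∫ s in τ..t, (f s
              + ρ (Real.exp (β * ω s) • FractionalSPDE.toV ι (ut₁ s))
              + η (Real.exp (β * ω s) • FractionalSPDE.toV ι (ut₂ s))))
            * ‖Real.exp (-β * ω τ) • u₁τ - Real.exp (-β * ω τ) • u₂τ‖ ^ 2) ∧
        (∀ t ∈ Icc τ (τ + T),
          ‖Real.exp (β * ω t) • ut₁ t - Real.exp (β * ω t) • ut₂ t‖ ^ 2 ≤
            C₀ * Real.exp (∫ s in τ..t, (f s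
              + ρ (FractionalSPDE.toV ι (Real.exp (β * ω s) • ut₁ s))
              + η (FractionalSPDE.toV ι (Real.exp (β * ω s) • ut₂ s))))
            * ‖u₁τ - u₂τ‖ ^ 2) ∧
        (∀ γ₂ : ℝ≥0, (γ₂ : ℝ) ≤ 1 / α → γ₂ ≤ γ₁ → 1 < γ₁ + γ₂ →
          FractionalSPDE.IsSPDESolution ι A β ω γ₂ α τ T u₁τ
            (fun t => Real.exp (β * ω t) • ut₁ t) ∧
          FractionalSPDE.IsSPDESolution ι A β ω γ₂ α τ T u₂τ
            (fun t => Real.exp (β * ω t) • ut₂ t))) ∧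
      -- arbitrary solutions `u₁, u₂` of the SPDE
      (∀ (γ₂ : ℝ≥0) (u₁τ u₂τ : H) (u₁ u₂ : ℝ → H), 1 < γ₁ + γ₂ →
        FractionalSPDE.IsSPDESolution ι A β ω γ₂ α τ T u₁τ u₁ →
        FractionalSPDE.IsSPDESolution ι A β ω γ₂ α τ T u₂τ u₂ →
        IntegrableOn (fun s => ρ (FractionalSPDE.toV ι (u₁ s))
          + η (FractionalSPDE.toV ι (u₂ s))) (Icc τ (τ + T)) →
        ∀ t ∈ Icc τ (τ + T),
          ‖u₁ t - u₂ t‖ ^ 2 ≤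
            C₀ * Real.exp (∫ s in τ..t, (f s
              + ρ (FractionalSPDE.toV ι (u₁ s)) + η (FractionalSPDE.toV ι (u₂ s))))
            * ‖u₁τ - u₂τ‖ ^ 2) := by
  have hγ : 0 < γ₁ := by rw [← NNReal.coe_pos]; linarith
  have hτ : τ ∈ Icc τ (τ + T) := ⟨le_rfl, by linarith⟩
  -- as `γ₁ < 1`, the condition on the sum of the exponents makes `γ₂` positive
  have hpos : ∀ {γ₂ : ℝ≥0}, 1 < γ₁ + γ₂ → 0 < γ₂ := fun {γ₂} h => by
    have h : (1 : ℝ) < γ₁ + γ₂ := by exact_mod_cast h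
    rw [← NNReal.coe_pos]; linarith
  have hcont : ContinuousOn (fun t => Real.exp (2 * β * (ω t - ω τ))) (Icc τ (τ + T)) :=
    (((hω.continuousOn hγ τ (τ + T)).sub continuousOn_const).const_mul _).rexp
  obtain ⟨M, hM⟩ := isCompact_Icc.exists_bound_of_continuousOn hcont
  have hM : ∀ t ∈ Icc τ (τ + T), Real.exp (2 * β * (ω t - ω τ)) ≤ M := fun t ht => by
    simpa using hM t ht
  refine ⟨M, (Real.exp_pos _).trans_le (hM τ hτ), ?_⟩
  intro V _ _ _ _ _ H _ _ _ _ ι hι A α ϖ c C f g η ρ hA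
  have := FractionalSPDE.secondCountableTopology_dual hι.reflexive hι.injective
  refine ⟨fun u₁τ u₂τ ut₁ ut₂ h₁ h₂ hint => ?_, fun γ₂ u₁τ u₂τ u₁ u₂ hγ₂ h₁ h₂ hint t ht => ?_⟩
  · have hle := fun t (ht : t ∈ Icc τ (τ + T)) =>
      h₁.norm_sub_sq_le hA hι.injective hι.dense hω hγ h₂ hint ht
    refine ⟨hle, fun t ht => ?_, fun γ₂ hγα hγγ hsum =>
      ⟨h₁.isSPDESolution hA hι.injective hT.le hω hγ₁ (hpos hsum) hγα hγγ,
        h₂.isSPDESolution hA hι.injective hT.le hω hγ₁ (hpos hsum) hγα hγγ⟩⟩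
    have h := FractionalSPDE.norm_sub_sq_le_of_scaled (Real.exp_pos _).le (hM t ht) (hle t ht)
    convert h using 4
    refine intervalIntegral.integral_congr_ae_restrict
      (FractionalSPDE.ae_restrict_uIoc ?_ hτ ht)
    filter_upwards [h₁.regular.ae_mem, h₂.regular.ae_mem] with s hs1 hs2
    rw [FractionalSPDE.toV_smul hι.injective _ hs1, FractionalSPDE.toV_smul hι.injective _ hs2]
  · have hr₁ := h₁.isRandomPDESolution hι.injective hT.le hω hγ₁ (hpos hγ₂) hγ₂
    have hr₂ := h₂.isRandomPDESolution hι.injective hT.le hω hγ₁ (hpos hγ₂) hγ₂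
    have hback : ∀ (s : ℝ) (h : H),
        Real.exp (β * ω s) • Real.exp (-β * ω s) • h = h := fun s h => by
      rw [smul_smul, FractionalSPDE.exp_mul_exp_neg, one_smul]
    have htoV : ∀ {u : ℝ → H} {s : ℝ}, u s ∈ range ι →
        Real.exp (β * ω s) • FractionalSPDE.toV ι (Real.exp (-β * ω s) • u s) =
          FractionalSPDE.toV ι (u s) := fun {u s} hs => by
      rw [FractionalSPDE.toV_smul hι.injective _ hs, smul_smul, FractionalSPDE.exp_mul_exp_neg,
        one_smul]
    have hint' : IntegrableOn (fun s =>
        ρ (Real.exp (β * ω s) • FractionalSPDE.toV ι (Real.exp (-β * ω s) • u₁ s))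
        + η (Real.exp (β * ω s) • FractionalSPDE.toV ι (Real.exp (-β * ω s) • u₂ s)))
        (Icc τ (τ + T)) := by
      refine hint.congr ?_
      filter_upwards [h₁.regular.ae_mem, h₂.regular.ae_mem] with s hs1 hs2
      rw [htoV hs1, htoV hs2]
    have hle := hr₁.norm_sub_sq_le hA hι.injective hι.dense hω hγ hr₂ hint' ht
    have h := FractionalSPDE.norm_sub_sq_le_of_scaled (Real.exp_pos _).le (hM t ht) hle
    rw [hback, hback] at h
    convert h using 4
    refine intervalIntegral.integral_congr_ae_restrict
      (FractionalSPDE.ae_restrict_uIoc ?_ hτ ht)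
    filter_upwards [h₁.regular.ae_mem, h₂.regular.ae_mem] with s hs1 hs2
    rw [htoV hs1, htoV hs2]
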